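/- Let $n\ge 0$ and $d\ge 1$ be integers, let $Y_1,\dots,Y_n$ be random Hermitian $d\times d$ complex matrices on a common probability space, and let $A_1,\dots,A_n$ be fixed Hermitian $d\times d$ matrices such that for every $k$ $$\mathbb{E}\,Y_k=0,\qquad Y_k^2\preceq A_k^2 \quad\text{almost surely},$$ where $\preceq$ is the positive semidefinite order. Put $\sigma^2:=\bigl\|\sum_k A_k^2\bigr\|$ (spectral norm). (i) If $Y_1,\dots,Y_n$ are independent, then for all $t\ge 0$, $$\mathbb{P}\Bigl\{\lambda_{\max}\Bigl(\sum_k Y_k\Bigr)\ge t\Bigr\}\le d\cdot e^{-t^2/(4\sigma^2)}.$$ (ii) Suppose instead that $(Y_1,\dots,Y_n)$ takes values in $\Lambda=\Lambda_1\times\dots\times\Lambda_n$ almost surely, with each $\Lambda_i$ a measurable set of $d\times d$ matrices, and that $D=(d_{ij})$ is a Dobrushin interdependence matrix for it: $D$ is a real $n\times n$ matrix with $d_{ij}\ge 0$ and $d_{ii}=0$, and there are versions $\mu_i(\cdot\mid x_{-i})$ of the regular conditional distributions of $Y_i$ given $(Y_j)_{j\ne i}=x_{-i}$ such that for all $i$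 and all $x,y\in\Lambda$ $$d_{TV}\bigl(\mu_i(\cdot\mid x_{-i}),\mu_i(\cdot\mid y_{-i})\bigr)\le\sum_{j=1}^n d_{ij}\,\mathbf 1[x_j\ne y_j],$$ where $d_{TV}(\mu,\nu)=\sup_S|\mu(S)-\nu(S)|$, the supremum being over measurable sets. Let $\|D\|_1$ and $\|D\|_\infty$ be the maximal column sum and the maximal row sum of $D$ ($0$ if $n=0$). If $\max(\|D\|_1,\|D\|_\infty)<1$, then for all $t\ge 0$, $$\mathbb{P}\Bigl\{\lambda_{\max}\Bigl(\sum_k Y_k\Bigr)\ge t\Bigr\}\le d\cdot e^{-t^2/(4c\sigma^2)},\qquad c:=\frac12\left(\frac{1}{1-\|D\|_1}+\frac{1}{1-\|D\|_\infty}\right).$$ If $\sigma^2=0$, the exponentials are read as $0$ for $t>0$ and as $1$ for $t=0$. -/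

import Mathlib

open MeasureTheory ProbabilityTheory
open scoped ComplexOrder

/-- Matrices carry the product (entrywise, i.e. Borel) σ-algebra. -/
instance Matrix.instMeasurableSpacePi {m n α : Type*} [MeasurableSpace α] :
    MeasurableSpace (Matrix m n α) :=
  inferInstanceAs (MeasurableSpace (m → n → α))

/-- The largest eigenvalue of a Hermitian matrix: the largest element of its real spectrum. -/
noncomputable def lambdaMax {d : ℕ} (A : Matrix (Fin d) (Fin d) ℂ) : ℝ :=
  sSup (spectrum ℝ A)

/-- The spectral norm of a complex matrix: its operator norm on Euclidean space `ℂ^d`. -/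
noncomputable def matOpNorm {d : ℕ} (A : Matrix (Fin d) (Fin d) ℂ) : ℝ :=
  ‖Matrix.toEuclideanCLM (𝕜 := ℂ) A‖

/-- The operator norm on `ℓ¹` of a real matrix: the maximal absolute column sum. -/
noncomputable def matNormOne {n : ℕ} (D : Matrix (Fin n) (Fin n) ℝ) : ℝ :=
  ⨆ j, ∑ i, |D i j|

/-- The operator norm on `ℓ^∞` of a real matrix: the maximal absolute row sum. -/
noncomputable def matNormInf {n : ℕ} (D : Matrix (Fin n) (Fin n) ℝ) : ℝ :=
  ⨆ i, ∑ j, |D i j|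

/-- Total variation distance of two probability measures:
the supremum of `|μ(s) - ν(s)|` over measurable sets `s`. -/
noncomputable def tvDist {α : Type*} [MeasurableSpace α] (μ ν : Measure α) : ℝ :=
  ⨆ s : {s : Set α // MeasurableSet s}, |μ.real s - ν.real s|

/-- `κ` is a (version of the regular) conditional distribution of `X i` given
`X_{-i} = (X j)_{j ≠ i}`: it is a Markov kernel that disintegrates the joint law. -/
def IsCondDistOfRest {Ω : Type*} [MeasurableSpace Ω] {n : ℕ} {E : Fin n → Type*}
    [∀ i, MeasurableSpace (E i)] (P : Measure Ω) (X : ∀ i, Ω → E i) (i : Fin n)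
    (κ : Kernel (∀ j : {j : Fin n // j ≠ i}, E j) (E i)) : Prop :=
  IsMarkovKernel κ ∧
    P.map (fun ω => ((fun j : {j : Fin n // j ≠ i} => X j ω), X i ω)) =
      (P.map (fun ω => fun j : {j : Fin n // j ≠ i} => X j ω)).compProd κ

open Classical in
/-- `D` is a Dobrushin interdependence matrix for the random vector `X = (X_1, …, X_n)` taking
values in `Λ = Λ_1 × ⋯ × Λ_n`: the entries are nonnegative, the diagonal vanishes, and for (some
versions of) the conditional distributions `μ_i(· | x_{-i})` of `X_i` given `X_{-i} = x_{-i}`,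
`d_TV(μ_i(· | x_{-i}), μ_i(· | y_{-i})) ≤ ∑_j d_ij 1[x_j ≠ y_j]` for all `i` and all `x, y ∈ Λ`. -/
structure IsDobrushinMatrix {Ω : Type*} [MeasurableSpace Ω] {n : ℕ} {E : Fin n → Type*}
    [∀ i, MeasurableSpace (E i)] (P : Measure Ω) (X : ∀ i, Ω → E i) (Λ : ∀ i, Set (E i))
    (D : Matrix (Fin n) (Fin n) ℝ) : Prop where
  measurableSet_states : ∀ i, MeasurableSet (Λ i)
  mem_states : ∀ i, ∀ᵐ ω ∂P, X i ω ∈ Λ i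
  nonneg : ∀ i j, 0 ≤ D i j
  diag_eq_zero : ∀ i, D i i = 0
  tv_le : ∃ κ : ∀ i, Kernel (∀ j : {j : Fin n // j ≠ i}, E j) (E i),
    (∀ i, IsCondDistOfRest P X i (κ i)) ∧
      ∀ i, ∀ x y : ∀ j, E j, (∀ j, x j ∈ Λ j) → (∀ j, y j ∈ Λ j) →
        tvDist (κ i fun j => x j) (κ i fun j => y j) ≤
          ∑ j, D i j * (if x j ≠ y j then 1 else 0)

/-- The constant `c = (1/(1 - ‖D‖₁) + 1/(1 - ‖D‖_∞)) / 2`. -/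
noncomputable def dobrushinConst {n : ℕ} (D : Matrix (Fin n) (Fin n) ℝ) : ℝ :=
  (1 / (1 - matNormOne D) + 1 / (1 - matNormInf D)) / 2

/-!
The bound is obtained from the trace moment generating function `m θ = 𝔼 tr exp (θ X)` of
`X = ∑ k, Y k`: the differential inequality `m' ≤ 2 c σ² θ m` integrates to
`m θ ≤ d exp (c σ² θ²)`, and the Laplace transform method then gives the tail bound
(`measureReal_le_lambdaMax_le`).

To bound `m' θ = 𝔼 tr (X exp (θ X))`, one writes `X` in terms of the Glauber dynamics, which
resamples a uniformly random coordinate from its conditional distribution given the others. If `F`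
solves the Poisson equation `∑ i, (F - resample i F) = X`, then, as resampling the `i`-th coordinate
turns the state `z` into an exchangeable copy `z'`,
`m' θ = ∑ i, ½ 𝔼 tr ((F z - F z') (exp (θ X z) - exp (θ X z')))`
(`IsReversibleResample.integral_sub_resample_mul`). Each term is estimated by the mean value trace
inequality `sum_exp_inner_sub_le`, which reduces the problem to bounds of the squares of
`X z - X z'` and of `F z - F z'`. The first is at most `4 A i ^ 2`.

For the second, `F` is the Neumann series of the Glauber operator applied to `X`
(`sum_poissonSum_sub_resample`). Dobrushin's condition says how oscillations in the single
coordinates evolve under the Glauber operator: a vector `δ` of oscillation bounds becomes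
`δ ((1 - 1/n) 1 + D/n)` (`OscLe.glauber`). Summing over the powers, `F z - F z'` is a sum of
matrices `B k` with `‖B k v‖ ≤ 2 (w k i) ‖A k v‖` for every vector `v`, where the nonnegative
weights `w` are dominated by the inverse of `1 - D`, so that their column sums are at most
`1 / (1 - ‖D‖₁)` and their row sums at most `1 / (1 - ‖D‖_∞)` (`sum_influenceSum_le`). The
Cauchy-Schwarz inequality and a suitable weight in the trace inequality produce the average `c` of
these two numbers. Only partial sums of the Neumann series are used; the remainder vanishes in the
limit because oscillations decay geometrically and `𝔼 X = 0`.

This argument needs the bounds `Y k ^ 2 ≤ A k ^ 2` and Dobrushin's condition at all points of the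
state space. Redefining the kernels and the matrices on null sets achieves this
(`IsDobrushinMatrix.exists_forall_tvDist_le`, `IsDobrushinMatrix.measureReal_le_lambdaMax_le`).

The independent case is the case `D = 0`, and if `σ² = 0` then every `Y k` vanishes almost surely.
-/

/-! ### Exponential trace inequalities -/

theorem Real.abs_exp_sub_exp_le (a b : ℝ) :
    |Real.exp a - Real.exp b| ≤ |a - b| * (Real.exp a + Real.exp b) / 2 := by
  wlog h : b ≤ a generalizing a b
  · have := this b a (le_of_not_ge h)
    rwa [abs_sub_comm, abs_sub_comm b a, add_comm (Real.exp b)] at this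
  rw [abs_of_nonneg (by linarith [Real.exp_le_exp.2 h]), abs_of_nonneg (by linarith)]
  -- with `x = a - b`, the function `x (e^x + 1) / 2 - (e^x - 1)` vanishes at `0` and increases
  have key : ∀ x : ℝ, 0 ≤ x → Real.exp x - 1 ≤ x * (Real.exp x + 1) / 2 := by
    intro x hx
    have hd : ∀ y : ℝ, HasDerivAt (fun y => y * (Real.exp y + 1) / 2 - (Real.exp y - 1))
        ((1 * (Real.exp y + 1) + y * Real.exp y) / 2 - Real.exp y) y := fun y =>
      ((((hasDerivAt_id y).mul ((Real.hasDerivAt_exp y).add_const 1)).div_const 2).sub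
        ((Real.hasDerivAt_exp y).sub_const 1))
    have hmono : Monotone (fun y => y * (Real.exp y + 1) / 2 - (Real.exp y - 1)) := by
      refine monotone_of_deriv_nonneg (fun y => (hd y).differentiableAt) fun y => ?_
      rw [(hd y).deriv]
      -- `1 - y ≤ e^(-y)`
      have h1 : (1 - y) * Real.exp y ≤ 1 := by
        have := mul_le_mul_of_nonneg_right (Real.one_sub_le_exp_neg y) (Real.exp_pos y).le
        rwa [← Real.exp_add, neg_add_cancel, Real.exp_zero] at this
      linarith
    have := hmono hx
    simp only [Real.exp_zero] at this
    linarith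
  have hk := mul_le_mul_of_nonneg_right (key (a - b) (by linarith)) (Real.exp_pos b).le
  have he : Real.exp (a - b) * Real.exp b = Real.exp a := by
    rw [← Real.exp_add, sub_add_cancel]
  calc Real.exp a - Real.exp b = (Real.exp (a - b) - 1) * Real.exp b := by rw [sub_mul, he, one_mul]
    _ ≤ _ := hk
    _ = (a - b) * (Real.exp (a - b) * Real.exp b + Real.exp b) / 2 := by ring
    _ = _ := by rw [he]

section TraceInequality

variable {V ι : Type*} [NormedAddCommGroup V] [InnerProductSpace ℂ V] [Fintype ι]

local notation "⟪" x ", " y "⟫" => inner ℂ x y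

/-- The mean value trace inequality in spectral form: `u`, `a` and `v`, `b` are eigenbases and
eigenvalues of `A` and `B`, so that the left side is the real part of
`tr (C (e^A - e^B))`. In the two bases the divided differences of `exp` appear, and these are at
most the average of the two exponentials. -/
theorem sum_exp_inner_sub_le {A B C : V →L[ℂ] V}
    (hA : A.IsSymmetric) (hB : B.IsSymmetric) (hC : C.IsSymmetric)
    (u v : OrthonormalBasis ι ℂ V) (a b : ι → ℝ)
    (hu : ∀ i, A (u i) = (a i : ℂ) • u i) (hv : ∀ i, B (v i) = (b i : ℂ) • v i)
    {s : ℝ} (hs : 0 < s) :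
    ∑ i, Real.exp (a i) * (⟪u i, C (u i)⟫).re - ∑ j, Real.exp (b j) * (⟪v j, C (v j)⟫).re ≤
      (∑ i, Real.exp (a i) * (s * ‖(A - B) (u i)‖ ^ 2 + s⁻¹ * ‖C (u i)‖ ^ 2) +
        ∑ j, Real.exp (b j) * (s * ‖(A - B) (v j)‖ ^ 2 + s⁻¹ * ‖C (v j)‖ ^ 2)) / 4 := by
  have hAB : (A - B).IsSymmetric := fun x y => by
    have h1 := hA x y
    have h2 := hB x y
    simp only [ContinuousLinearMap.coe_coe] at h1 h2 ⊢
    simp only [sub_apply, inner_sub_left, inner_sub_right, h1, h2]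
  have h1 : ∀ i, (⟪u i, C (u i)⟫).re = ∑ j, (⟪u i, v j⟫ * ⟪v j, C (u i)⟫).re := fun i => by
    rw [← v.sum_inner_mul_inner, Complex.re_sum]
  have h2 : ∀ j, (⟪v j, C (v j)⟫).re = ∑ i, (⟪u i, v j⟫ * ⟪v j, C (u i)⟫).re := fun j => by
    rw [← Complex.re_sum, show ⟪v j, C (v j)⟫ = ⟪C (v j), v j⟫ from (hC (v j) (v j)).symm,
      ← u.sum_inner_mul_inner (C (v j)) (v j)]
    refine congrArg _ (Finset.sum_congr rfl fun i _ => ?_)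
    rw [mul_comm, show ⟪v j, C (u i)⟫ = ⟪C (v j), u i⟫ from (hC (v j) (u i)).symm]
  have hentry : ∀ i j, (a i - b j : ℝ) * ⟪u i, v j⟫ = ⟪u i, (A - B) (v j)⟫ := fun i j => by
    have h3 : ⟪u i, A (v j)⟫ = (a i : ℂ) * ⟪u i, v j⟫ := by
      have := hA (u i) (v j)
      simp only [ContinuousLinearMap.coe_coe] at this
      rw [← this, hu, inner_smul_left, Complex.conj_ofReal]
    rw [sub_apply, inner_sub_right, h3, hv, inner_smul_right]
    push_cast
    ring
  calc ∑ i, Real.exp (a i) * (⟪u i, C (u i)⟫).re - ∑ j, Real.exp (b j) * (⟪v j, C (v j)⟫).re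
      = ∑ i, ∑ j, (Real.exp (a i) - Real.exp (b j)) * (⟪u i, v j⟫ * ⟪v j, C (u i)⟫).re := by
        simp_rw [h1, h2, Finset.mul_sum, sub_mul, Finset.sum_sub_distrib]
        congr 1
        exact Finset.sum_comm
    _ ≤ ∑ i, ∑ j, (Real.exp (a i) + Real.exp (b j)) *
          (s * ‖⟪u i, (A - B) (v j)⟫‖ ^ 2 + s⁻¹ * ‖⟪v j, C (u i)⟫‖ ^ 2) / 4 := by
        refine Finset.sum_le_sum fun i _ => Finset.sum_le_sum fun j _ => ?_
        have h3 : |(⟪u i, v j⟫ * ⟪v j, C (u i)⟫).re| ≤ ‖⟪u i, v j⟫‖ * ‖⟪v j, C (u i)⟫‖ :=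
          (Complex.abs_re_le_norm _).trans (norm_mul _ _).le
        have h4 : |a i - b j| * ‖⟪u i, v j⟫‖ = ‖⟪u i, (A - B) (v j)⟫‖ := by
          rw [← hentry, norm_mul, Complex.norm_real, Real.norm_eq_abs]
        have h5 := Real.abs_exp_sub_exp_le (a i) (b j)
        set p := ‖⟪u i, (A - B) (v j)⟫‖
        set q := ‖⟪v j, C (u i)⟫‖
        have hq : 0 ≤ q := norm_nonneg _
        have hE : 0 ≤ Real.exp (a i) + Real.exp (b j) := by positivity
        have hpq : p * q ≤ (s * p ^ 2 + s⁻¹ * q ^ 2) / 2 := by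
          have : 0 ≤ s⁻¹ * (s * p - q) ^ 2 := by positivity
          have e : s⁻¹ * (s * p - q) ^ 2 = s * p ^ 2 + s⁻¹ * q ^ 2 - 2 * (p * q) := by
            field_simp
            ring
          linarith
        calc _ ≤ |(Real.exp (a i) - Real.exp (b j)) * (⟪u i, v j⟫ * ⟪v j, C (u i)⟫).re| :=
              le_abs_self _
          _ ≤ (|a i - b j| * (Real.exp (a i) + Real.exp (b j)) / 2) * (‖⟪u i, v j⟫‖ * q) := by
              rw [abs_mul]
              exact mul_le_mul h5 h3 (abs_nonneg _) (by positivity)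
          _ = (Real.exp (a i) + Real.exp (b j)) / 2 * (p * q) := by rw [← h4]; ring
          _ ≤ (Real.exp (a i) + Real.exp (b j)) / 2 * ((s * p ^ 2 + s⁻¹ * q ^ 2) / 2) := by gcongr
          _ = _ := by ring
    _ = _ := by
        have e1 : ∀ i, s * ‖(A - B) (u i)‖ ^ 2 + s⁻¹ * ‖C (u i)‖ ^ 2 =
            ∑ j, (s * ‖⟪u i, (A - B) (v j)⟫‖ ^ 2 + s⁻¹ * ‖⟪v j, C (u i)⟫‖ ^ 2) := fun i => by
          rw [Finset.sum_add_distrib, ← Finset.mul_sum, ← Finset.mul_sum,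
            v.sum_sq_norm_inner_right, ← v.sum_sq_norm_inner_left]
          simp_rw [show ∀ j, ⟪u i, (A - B) (v j)⟫ = ⟪(A - B) (u i), v j⟫ from
            fun j => (hAB (u i) (v j)).symm]
        have e2 : ∀ j, s * ‖(A - B) (v j)‖ ^ 2 + s⁻¹ * ‖C (v j)‖ ^ 2 =
            ∑ i, (s * ‖⟪u i, (A - B) (v j)⟫‖ ^ 2 + s⁻¹ * ‖⟪v j, C (u i)⟫‖ ^ 2) := fun j => by
          rw [Finset.sum_add_distrib, ← Finset.mul_sum, ← Finset.mul_sum,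
            u.sum_sq_norm_inner_right, ← u.sum_sq_norm_inner_left]
          simp_rw [show ∀ i, ⟪v j, C (u i)⟫ = ⟪C (v j), u i⟫ from
            fun i => (hC (v j) (u i)).symm]
          rw [← u.sum_sq_norm_inner_left (C (v j))]
        simp_rw [e1, e2, Finset.mul_sum, add_mul, add_div, Finset.sum_add_distrib, ← Finset.sum_div]
        congr 2
        exact Finset.sum_comm

end TraceInequality

section MatrixTrace

open scoped Matrix.Norms.L2Operator

variable {d : ℕ}

local notation "op" => Matrix.toEuclideanCLM (𝕜 := ℂ)

theorem Matrix.IsHermitian.isSymmetric_toEuclideanCLM {A : Matrix (Fin d) (Fin d) ℂ}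
    (hA : A.IsHermitian) : (op A).IsSymmetric :=
  Matrix.isSymmetric_toEuclideanLin_iff.2 hA

theorem Matrix.norm_toEuclideanCLM_apply_le (M : Matrix (Fin d) (Fin d) ℂ)
    (v : EuclideanSpace ℂ (Fin d)) : ‖op M v‖ ≤ ‖M‖ * ‖v‖ := by
  rw [← Matrix.l2_opNorm_toEuclideanCLM]
  exact (op M).le_opNorm v

theorem Matrix.abs_re_inner_le (Q : Matrix (Fin d) (Fin d) ℂ) (v : EuclideanSpace ℂ (Fin d)) :
    |(inner ℂ v (op Q v)).re| ≤ ‖Q‖ * ‖v‖ ^ 2 :=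
  calc _ ≤ ‖inner ℂ v (op Q v)‖ := Complex.abs_re_le_norm _
    _ ≤ ‖v‖ * ‖op Q v‖ := norm_inner_le_norm _ _
    _ ≤ ‖v‖ * (‖Q‖ * ‖v‖) := by gcongr; exact Q.norm_toEuclideanCLM_apply_le v
    _ = _ := by ring

theorem Matrix.toEuclideanCLM_exp_apply_of_eigenvector {Y : Matrix (Fin d) (Fin d) ℂ}
    {v : EuclideanSpace ℂ (Fin d)} {a : ℝ} (h : op Y v = (a : ℂ) • v) :
    op (NormedSpace.exp Y) v = (Real.exp a : ℂ) • v := by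
  have hpow : ∀ m : ℕ, op (Y ^ m) v = (a : ℂ) ^ m • v := fun m => by
    induction m with
    | zero => simp
    | succ m ih => rw [pow_succ', map_mul, mul_apply_eq_comp, ih, map_smul, h, smul_smul,
        pow_succ]
  have hs := NormedSpace.exp_series_hasSum_exp' (𝕂 := ℂ) Y
  have hs2 := hs.map ((LinearMap.applyₗ v).comp (Matrix.toEuclideanLin (𝕜 := ℂ)).toLinearMap)
    (LinearMap.continuous_of_finiteDimensional _)
  have hs3 := (NormedSpace.exp_series_hasSum_exp' (𝕂 := ℂ) (a : ℂ)).smul_const v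
  rw [← Complex.exp_eq_exp_ℂ] at hs3
  rw [Complex.ofReal_exp]
  refine hs2.unique ?_
  convert hs3 using 2 with m
  have := hpow m
  simp only [Function.comp_apply, map_smul]
  rw [smul_assoc]
  exact congrArg _ this

theorem Matrix.IsHermitian.toEuclideanCLM_smul_eigenvectorBasis {X : Matrix (Fin d) (Fin d) ℂ}
    (hX : X.IsHermitian) (θ : ℝ) (i : Fin d) :
    op (θ • X) (hX.eigenvectorBasis i) =
      ((θ * hX.eigenvalues i : ℝ) : ℂ) • hX.eigenvectorBasis i := by
  have h : op X (hX.eigenvectorBasis i) = (hX.eigenvalues i : ℂ) • hX.eigenvectorBasis i := by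
    ext j
    rw [Matrix.ofLp_toEuclideanCLM, hX.mulVec_eigenvectorBasis]
    simp
  rw [← Complex.coe_smul, map_smul, _root_.smul_apply, h, smul_smul, Complex.ofReal_mul]

theorem Matrix.IsHermitian.toEuclideanCLM_exp_smul_eigenvectorBasis
    {X : Matrix (Fin d) (Fin d) ℂ} (hX : X.IsHermitian) (θ : ℝ) (i : Fin d) :
    op (NormedSpace.exp (θ • X)) (hX.eigenvectorBasis i) =
      (Real.exp (θ * hX.eigenvalues i) : ℂ) • hX.eigenvectorBasis i :=
  Matrix.toEuclideanCLM_exp_apply_of_eigenvector (hX.toEuclideanCLM_smul_eigenvectorBasis θ i)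

/-- The trace of `Q e^{θ X}`, evaluated in an eigenbasis of `X`. -/
theorem Matrix.IsHermitian.trace_mul_exp_smul {X : Matrix (Fin d) (Fin d) ℂ}
    (hX : X.IsHermitian) (Q : Matrix (Fin d) (Fin d) ℂ) (θ : ℝ) :
    (Q * NormedSpace.exp (θ • X)).trace = ∑ i, (Real.exp (θ * hX.eigenvalues i) : ℂ) *
      inner ℂ (hX.eigenvectorBasis i) (op Q (hX.eigenvectorBasis i)) := by
  have h1 : ∀ M : Matrix (Fin d) (Fin d) ℂ, M.trace = ∑ i, inner ℂ (hX.eigenvectorBasis i)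
      (op M (hX.eigenvectorBasis i)) := fun M => by
    rw [← Matrix.trace_toLin_eq M (EuclideanSpace.basisFun (Fin d) ℂ).toBasis]
    exact LinearMap.trace_eq_sum_inner _ hX.eigenvectorBasis
  rw [h1]
  refine Finset.sum_congr rfl fun i _ => ?_
  rw [map_mul, mul_apply_eq_comp, hX.toEuclideanCLM_exp_smul_eigenvectorBasis, map_smul,
    inner_smul_right]

theorem Matrix.IsHermitian.re_trace_mul_exp_smul {X : Matrix (Fin d) (Fin d) ℂ}
    (hX : X.IsHermitian) (Q : Matrix (Fin d) (Fin d) ℂ) (θ : ℝ) :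
    (Q * NormedSpace.exp (θ • X)).trace.re = ∑ i, Real.exp (θ * hX.eigenvalues i) *
      (inner ℂ (hX.eigenvectorBasis i) (op Q (hX.eigenvectorBasis i))).re := by
  rw [hX.trace_mul_exp_smul, Complex.re_sum]
  exact Finset.sum_congr rfl fun i _ => Complex.re_ofReal_mul _ _

theorem Matrix.IsHermitian.re_trace_exp_smul {X : Matrix (Fin d) (Fin d) ℂ}
    (hX : X.IsHermitian) (θ : ℝ) :
    (NormedSpace.exp (θ • X)).trace.re = ∑ i, Real.exp (θ * hX.eigenvalues i) := by
  have := hX.re_trace_mul_exp_smul 1 θ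
  rw [one_mul] at this
  rw [this]
  refine Finset.sum_congr rfl fun i _ => ?_
  rw [map_one, one_apply_eq_self, inner_self_eq_norm_sq_to_K,
    hX.eigenvectorBasis.orthonormal.1 i]
  simp

/-- The functional `Q ↦ tr (Q e^{θ X})` is monotone for the Loewner order. -/
theorem Matrix.IsHermitian.re_trace_mul_exp_smul_le {X : Matrix (Fin d) (Fin d) ℂ}
    (hX : X.IsHermitian) {Q : Matrix (Fin d) (Fin d) ℂ} (θ : ℝ) {q : ℝ}
    (h : ∀ v, (inner ℂ v (op Q v)).re ≤ q * ‖v‖ ^ 2) :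
    (Q * NormedSpace.exp (θ • X)).trace.re ≤ q * (NormedSpace.exp (θ • X)).trace.re := by
  rw [hX.re_trace_mul_exp_smul, hX.re_trace_exp_smul, Finset.mul_sum]
  refine Finset.sum_le_sum fun i _ => ?_
  rw [mul_comm q]
  gcongr
  simpa [hX.eigenvectorBasis.orthonormal.1 i] using h (hX.eigenvectorBasis i)

theorem Matrix.IsHermitian.abs_re_trace_mul_exp_smul_le {X : Matrix (Fin d) (Fin d) ℂ}
    (hX : X.IsHermitian) (Q : Matrix (Fin d) (Fin d) ℂ) (θ : ℝ) :
    |(Q * NormedSpace.exp (θ • X)).trace.re| ≤ ‖Q‖ * (NormedSpace.exp (θ • X)).trace.re := by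
  rw [abs_le']
  refine ⟨hX.re_trace_mul_exp_smul_le θ fun v => (le_abs_self _).trans (Q.abs_re_inner_le v), ?_⟩
  have := hX.re_trace_mul_exp_smul_le (Q := -Q) (q := ‖Q‖) θ fun v => by
    rw [map_neg, _root_.neg_apply, inner_neg_right, Complex.neg_re]
    exact (neg_le_abs _).trans (Q.abs_re_inner_le v)
  simpa using this

/-- The mean value trace inequality: `re tr (C (e^{θX} - e^{θZ}))` is controlled by any `Q` that
dominates `s θ² (X - Z)² + s⁻¹ C²`. -/
theorem Matrix.re_trace_mul_exp_sub_exp_le {X Z C Q : Matrix (Fin d) (Fin d) ℂ}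
    (hX : X.IsHermitian) (hZ : Z.IsHermitian) (hC : C.IsHermitian) (θ : ℝ) {s : ℝ} (hs : 0 < s)
    (hQ : ∀ v, s * (θ ^ 2 * ‖op (X - Z) v‖ ^ 2) + s⁻¹ * ‖op C v‖ ^ 2 ≤ (inner ℂ v (op Q v)).re) :
    (C * (NormedSpace.exp (θ • X) - NormedSpace.exp (θ • Z))).trace.re ≤
      ((Q * NormedSpace.exp (θ • X)).trace.re + (Q * NormedSpace.exp (θ • Z)).trace.re) / 4 := by
  have hsymm : ∀ {M : Matrix (Fin d) (Fin d) ℂ}, M.IsHermitian → (op (θ • M)).IsSymmetric :=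
    fun {M} hM => Matrix.IsHermitian.isSymmetric_toEuclideanCLM <| by
      rw [Matrix.IsHermitian, Matrix.conjTranspose_smul, hM.eq, star_trivial]
  have heig : ∀ {M : Matrix (Fin d) (Fin d) ℂ} (hM : M.IsHermitian) (i : Fin d),
      op (θ • M) (hM.eigenvectorBasis i) =
        ((θ * hM.eigenvalues i : ℝ) : ℂ) • hM.eigenvectorBasis i :=
    fun hM i => hM.toEuclideanCLM_smul_eigenvectorBasis θ i
  have key := sum_exp_inner_sub_le (hsymm hX) (hsymm hZ) hC.isSymmetric_toEuclideanCLM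
    hX.eigenvectorBasis hZ.eigenvectorBasis _ _ (heig hX) (heig hZ) hs
  have hsub : ∀ v, ‖(op (θ • X) - op (θ • Z)) v‖ ^ 2 = θ ^ 2 * ‖op (X - Z) v‖ ^ 2 := fun v => by
    rw [← map_sub, ← smul_sub, ← Complex.coe_smul, map_smul, _root_.smul_apply, norm_smul, mul_pow,
      Complex.norm_real, Real.norm_eq_abs, sq_abs]
  rw [mul_sub, Matrix.trace_sub, Complex.sub_re, hX.re_trace_mul_exp_smul,
    hZ.re_trace_mul_exp_smul, hX.re_trace_mul_exp_smul, hZ.re_trace_mul_exp_smul]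
  refine key.trans ?_
  simp_rw [hsub]
  gcongr <;> exact hQ _

theorem exp_mul_lambdaMax_le (hd : 1 ≤ d) {X : Matrix (Fin d) (Fin d) ℂ}
    (hX : X.IsHermitian) {θ : ℝ} :
    Real.exp (θ * lambdaMax X) ≤ (NormedSpace.exp (θ • X)).trace.re := by
  have : NeZero d := ⟨by omega⟩
  have hmem : lambdaMax X ∈ spectrum ℝ X := by
    refine Set.Nonempty.csSup_mem ?_ ?_
    · exact ⟨_, hX.eigenvalues_mem_spectrum_real 0⟩
    · exact Matrix.finite_real_spectrum
  rw [hX.spectrum_real_eq_range_eigenvalues] at hmem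
  obtain ⟨i, hi⟩ := hmem
  rw [hX.re_trace_exp_smul, ← hi]
  exact Finset.single_le_sum (f := fun i => Real.exp (θ * hX.eigenvalues i))
    (fun j _ => (Real.exp_pos _).le) (Finset.mem_univ i)

end MatrixTrace

/-! ### Total variation and oscillation -/

section TotalVariation

variable {α V : Type*} [MeasurableSpace α] [NormedAddCommGroup V]

theorem abs_measureReal_sub_le_tvDist (μ ν : Measure α) [IsProbabilityMeasure μ]
    [IsProbabilityMeasure ν] {s : Set α} (hs : MeasurableSet s) :
    |μ.real s - ν.real s| ≤ tvDist μ ν := by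
  refine le_ciSup (f := fun s : {s : Set α // MeasurableSet s} => |μ.real s - ν.real s|)
    ⟨1, ?_⟩ ⟨s, hs⟩
  rintro _ ⟨s, rfl⟩
  rw [abs_le]
  constructor <;> linarith [measureReal_nonneg (μ := μ) (s := s.1),
    measureReal_le_one (μ := μ) (s := s.1), measureReal_nonneg (μ := ν) (s := s.1),
    measureReal_le_one (μ := ν) (s := s.1)]

/-- A function is bounded and strongly measurable; such functions are integrable with respect to
every probability measure. -/
structure IsBddMeas (f : α → V) : Prop where
  stronglyMeasurable : StronglyMeasurable f
  bdd : ∃ C, ∀ x, ‖f x‖ ≤ C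

theorem IsBddMeas.integrable {f : α → V} (hf : IsBddMeas f) (μ : Measure α) [IsFiniteMeasure μ] :
    Integrable f μ :=
  let ⟨C, hC⟩ := hf.bdd
  Integrable.of_bound hf.stronglyMeasurable.aestronglyMeasurable C (ae_of_all _ hC)

theorem IsBddMeas.comp {β : Type*} [MeasurableSpace β] {f : α → V} (hf : IsBddMeas f) {g : β → α}
    (hg : Measurable g) : IsBddMeas fun x => f (g x) :=
  ⟨hf.stronglyMeasurable.comp_measurable hg, hf.bdd.imp fun _ h x => h (g x)⟩

theorem IsBddMeas.add {f g : α → V} (hf : IsBddMeas f) (hg : IsBddMeas g) :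
    IsBddMeas fun x => f x + g x := by
  obtain ⟨C, hC⟩ := hf.bdd
  obtain ⟨C', hC'⟩ := hg.bdd
  exact ⟨hf.stronglyMeasurable.add hg.stronglyMeasurable, C + C',
    fun x => (norm_add_le _ _).trans (add_le_add (hC x) (hC' x))⟩

theorem IsBddMeas.sum {κ : Type*} {s : Finset κ} {f : κ → α → V}
    (hf : ∀ k ∈ s, IsBddMeas (f k)) : IsBddMeas fun x => ∑ k ∈ s, f k x := by
  classical
  induction s using Finset.induction_on with
  | empty => exact ⟨by simpa using stronglyMeasurable_const, 0, by simp⟩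
  | insert a s ha ih =>
    simp only [Finset.sum_insert ha]
    exact (hf a (Finset.mem_insert_self a s)).add
      (ih fun k hk => hf k (Finset.mem_insert_of_mem hk))

variable [NormedSpace ℝ V]

theorem IsBddMeas.clm_comp {W : Type*} [NormedAddCommGroup W] [NormedSpace ℝ W] {f : α → V}
    (hf : IsBddMeas f) (L : V →L[ℝ] W) : IsBddMeas fun x => L (f x) := by
  obtain ⟨C, hC⟩ := hf.bdd
  refine ⟨L.continuous.comp_stronglyMeasurable hf.stronglyMeasurable, ‖L‖ * C, fun x => ?_⟩
  exact (L.le_opNorm _).trans (by gcongr; exact hC x)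

theorem IsBddMeas.const_smul {f : α → V} (hf : IsBddMeas f) (c : ℝ) :
    IsBddMeas fun x => c • f x :=
  hf.clm_comp (c • ContinuousLinearMap.id ℝ V)

theorem IsBddMeas.sub {f g : α → V} (hf : IsBddMeas f) (hg : IsBddMeas g) :
    IsBddMeas fun x => f x - g x := by
  simpa [sub_eq_add_neg] using hf.add (hg.const_smul (-1))

theorem integral_sub_integral_le_of_tvDist_le {μ ν : Measure α} [IsProbabilityMeasure μ]
    [IsProbabilityMeasure ν] {τ : ℝ} (hτ : tvDist μ ν ≤ τ) {g : α → ℝ} (hg : IsBddMeas g)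
    {L : ℝ} (hL : ∀ x y, g x - g y ≤ L) : ∫ x, g x ∂μ - ∫ x, g x ∂ν ≤ τ * L := by
  have : Nonempty α := nonempty_of_isProbabilityMeasure μ
  obtain ⟨C, hC⟩ := hg.bdd
  -- after subtracting the infimum, `h` takes values in `[0, L]`
  have hbdd : BddBelow (Set.range g) := ⟨-C, by rintro _ ⟨x, rfl⟩; exact (abs_le.1 (hC x)).1⟩
  set h : α → ℝ := fun x => g x - ⨅ y, g y with hh
  have h0 : ∀ x, 0 ≤ h x := fun x => sub_nonneg.2 (ciInf_le hbdd x)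
  have h1 : ∀ x, h x ≤ L := fun x => by
    have : g x - L ≤ ⨅ y, g y := le_ciInf fun y => by linarith [hL x y]
    simp only [hh]
    linarith
  have hL0 : 0 ≤ L := (h0 (Classical.arbitrary α)).trans (h1 _)
  have hint : ∀ (m : Measure α) [IsFiniteMeasure m], Integrable h m := fun m _ =>
    (hg.integrable m).sub (integrable_const _)
  have hshift : ∀ (m : Measure α) [IsProbabilityMeasure m],
      ∫ x, h x ∂m = ∫ x, g x ∂m - ⨅ y, g y := fun m _ => by
    rw [hh, integral_sub (hg.integrable m) (integrable_const _)]
    simp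
  -- on `s`, where `ν ≤ μ`, compare the integrals of `L - h`; on the complement, those of `h`
  obtain ⟨s, hs⟩ := exists_isHahnDecomposition ν μ
  have e1 : ∫ x in sᶜ, h x ∂μ ≤ ∫ x in sᶜ, h x ∂ν :=
    integral_mono_measure hs.ge_on_compl (ae_of_all _ h0) (hint _)
  have e2 : ∫ x in s, (L - h x) ∂ν ≤ ∫ x in s, (L - h x) ∂μ :=
    integral_mono_measure hs.le_on (ae_of_all _ fun x => sub_nonneg.2 (h1 x))
      ((integrable_const _).sub (hint _))
  rw [integral_sub (integrable_const _) (hint _), integral_sub (integrable_const _) (hint _)] at e2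
  simp only [integral_const, smul_eq_mul, measureReal_restrict_apply_univ] at e2
  have e3 := (le_abs_self _).trans ((abs_measureReal_sub_le_tvDist μ ν hs.measurableSet).trans hτ)
  have e4 := hshift μ
  have e5 := hshift ν
  rw [← integral_add_compl hs.measurableSet (hint _)] at e4 e5
  have e6 := mul_le_mul_of_nonneg_right e3 hL0
  linarith

/-- Kantorovich duality for the discrete metric: integrals against two probability measures
differ by at most the total variation distance times the oscillation of the integrand. -/
theorem norm_integral_sub_integral_le_of_tvDist_le [CompleteSpace V] {μ ν : Measure α}
    [IsProbabilityMeasure μ] [IsProbabilityMeasure ν] {τ : ℝ} (hτ : tvDist μ ν ≤ τ) {g : α → V}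
    (hg : IsBddMeas g) {L : ℝ} (hL : ∀ x y, ‖g x - g y‖ ≤ L) :
    ‖∫ x, g x ∂μ - ∫ x, g x ∂ν‖ ≤ τ * L := by
  obtain ⟨φ, hφ, hφ2⟩ := exists_dual_vector'' ℝ (∫ x, g x ∂μ - ∫ x, g x ∂ν)
  simp only [RCLike.ofReal_real_eq_id, id_eq] at hφ2
  rw [← hφ2, map_sub, ← φ.integral_comp_comm (hg.integrable μ),
    ← φ.integral_comp_comm (hg.integrable ν)]
  refine integral_sub_integral_le_of_tvDist_le hτ (hg.clm_comp φ) fun x y => ?_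
  rw [← map_sub]
  calc _ ≤ ‖φ (g x - g y)‖ := le_abs_self _
    _ ≤ 1 * ‖g x - g y‖ := φ.le_of_opNorm_le hφ _
    _ ≤ L := by rw [one_mul]; exact hL x y

end TotalVariation

/-! ### The Glauber dynamics -/

section Glauber

variable {ι S V : Type*} [DecidableEq ι] [NormedAddCommGroup V]

/-- `δ j` bounds the change of `f` when only the `j`-th coordinate is changed. -/
def OscLe (f : (ι → S) → V) (δ : ι → ℝ) : Prop :=
  ∀ z j s, ‖f (Function.update z j s) - f z‖ ≤ δ j

/-- Changing the coordinates one after the other. -/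
theorem OscLe.norm_sub_le [Fintype ι] {f : (ι → S) → V} {δ : ι → ℝ} (hδ : OscLe f δ) (x y : ι → S) :
    ‖f x - f y‖ ≤ ∑ j, δ j := by
  have key : ∀ s : Finset ι, ‖f (s.piecewise x y) - f y‖ ≤ ∑ j ∈ s, δ j := fun s => by
    induction s using Finset.induction_on with
    | empty => simp
    | insert a s ha ih =>
      rw [Finset.sum_insert ha, Finset.piecewise_insert]
      exact (norm_sub_le_norm_sub_add_norm_sub _ (f (s.piecewise x y)) _).trans
        (add_le_add (hδ _ a _) ih)
  simpa using key Finset.univ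

variable [MeasurableSpace S]

theorem measurable_update_prod (i : ι) :
    Measurable fun p : (ι → S) × S => Function.update p.1 i p.2 :=
  measurable_update'

theorem IsBddMeas.comp_update {f : (ι → S) → V} (hf : IsBddMeas f) (z : ι → S) (i : ι) :
    IsBddMeas fun u => f (Function.update z i u) :=
  hf.comp (measurable_update z)

variable [NormedSpace ℝ V]

/-- The expected value of `f` after the `i`-th coordinate has been resampled from `κ`. -/
noncomputable def resample (κ : Kernel (ι → S) S) (i : ι) (f : (ι → S) → V) (z : ι → S) : V :=
  ∫ u, f (Function.update z i u) ∂κ z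

theorem IsBddMeas.resample {f : (ι → S) → V} (hf : IsBddMeas f) (κ : Kernel (ι → S) S)
    [IsMarkovKernel κ] (i : ι) : IsBddMeas (resample κ i f) := by
  obtain ⟨C, hC⟩ := hf.bdd
  refine ⟨(hf.stronglyMeasurable.comp_measurable
    (measurable_update_prod i)).integral_kernel_prod_right', C, fun z => ?_⟩
  exact (norm_integral_le_of_norm_le_const (μ := κ z)
    (ae_of_all _ fun u => hC (Function.update z i u))).trans (by simp)

theorem clm_resample [CompleteSpace V] {W : Type*} [NormedAddCommGroup W] [NormedSpace ℝ W]
    [CompleteSpace W] (L : V →L[ℝ] W) {κ : Kernel (ι → S) S} [IsMarkovKernel κ] {i : ι}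
    {f : (ι → S) → V} (hf : IsBddMeas f) (z : ι → S) :
    L (resample κ i f z) = resample κ i (fun z => L (f z)) z :=
  (L.integral_comp_comm ((hf.comp_update z i).integrable _)).symm

/-- Resampling the `i`-th coordinate removes the influence of that coordinate, at the price of
adding `D i j` times the oscillation in the `i`-th coordinate to the one in the `j`-th. -/
theorem OscLe.norm_resample_sub_le [CompleteSpace V] {f : (ι → S) → V} {δ : ι → ℝ}
    (hδ : OscLe f δ) (hf : IsBddMeas f) {κ : Kernel (ι → S) S} [IsMarkovKernel κ] {i j : ι}
    {τ : ℝ} {z : ι → S} {s : S} (htv : tvDist (κ (Function.update z j s)) (κ z) ≤ τ) :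
    ‖resample κ i f (Function.update z j s) - resample κ i f z‖ ≤
      (if i = j then 0 else δ j) + τ * δ i := by
  have h1 : ‖resample κ i f (Function.update z j s) - ∫ u, f (Function.update z i u)
      ∂κ (Function.update z j s)‖ ≤ if i = j then 0 else δ j := by
    rw [resample, ← integral_sub ((hf.comp_update _ i).integrable _)
      ((hf.comp_update _ i).integrable _)]
    refine (norm_integral_le_of_norm_le_const (C := if i = j then 0 else δ j)
      (ae_of_all _ fun u => ?_)).trans (by simp)
    split_ifs with h
    · subst h
      simp
    · rw [Function.update_comm (Ne.symm h)]
      exact hδ _ j s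
  have h2 : ‖∫ u, f (Function.update z i u) ∂κ (Function.update z j s) - resample κ i f z‖ ≤
      τ * δ i := by
    refine norm_integral_sub_integral_le_of_tvDist_le htv (hf.comp_update z i) fun x y => ?_
    have := hδ (Function.update z i y) i x
    rwa [Function.update_idem] at this
  exact (norm_sub_le_norm_sub_add_norm_sub _ _ _).trans (add_le_add h1 h2)

variable [Fintype ι]

/-- The transition operator of the Glauber dynamics, which resamples a uniformly random
coordinate `i` from `η i`. -/
noncomputable def glauber (η : ι → Kernel (ι → S) S) (f : (ι → S) → V) (z : ι → S) : V :=
  (Fintype.card ι : ℝ)⁻¹ • ∑ i, resample (η i) i f z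

/-- How oscillation bounds evolve in one step of the Glauber dynamics: the matrix
`(1 - 1/n) 1 + D/n`. -/
noncomputable def influenceStep (D : Matrix ι ι ℝ) : Matrix ι ι ℝ :=
  (Fintype.card ι : ℝ)⁻¹ • (((Fintype.card ι : ℝ) - 1) • 1 + D)

theorem IsBddMeas.glauber {f : (ι → S) → V} (hf : IsBddMeas f) (η : ι → Kernel (ι → S) S)
    [∀ i, IsMarkovKernel (η i)] : IsBddMeas (glauber η f) :=
  (IsBddMeas.sum fun i _ => hf.resample (η i) i).const_smul _

theorem IsBddMeas.glauber_iterate {f : (ι → S) → V} (hf : IsBddMeas f)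
    (η : ι → Kernel (ι → S) S) [∀ i, IsMarkovKernel (η i)] (t : ℕ) :
    IsBddMeas ((_root_.glauber η)^[t] f) := by
  induction t with
  | zero => exact hf
  | succ t ih => rw [Function.iterate_succ_apply']; exact ih.glauber η

theorem clm_glauber_iterate [CompleteSpace V] {W : Type*} [NormedAddCommGroup W] [NormedSpace ℝ W]
    [CompleteSpace W] (L : V →L[ℝ] W) {η : ι → Kernel (ι → S) S} [∀ i, IsMarkovKernel (η i)]
    {f : (ι → S) → V} (hf : IsBddMeas f) (t : ℕ) (z : ι → S) :
    L ((glauber η)^[t] f z) = (glauber η)^[t] (fun z => L (f z)) z := by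
  induction t generalizing z with
  | zero => rfl
  | succ t ih =>
    rw [Function.iterate_succ_apply', Function.iterate_succ_apply', glauber, glauber, map_smul,
      map_sum]
    simp_rw [clm_resample L (hf.glauber_iterate η t), ih]

theorem OscLe.glauber [CompleteSpace V] {f : (ι → S) → V} {δ : ι → ℝ}
    (hδ : OscLe f δ) (hf : IsBddMeas f) {η : ι → Kernel (ι → S) S} [∀ i, IsMarkovKernel (η i)]
    {D : Matrix ι ι ℝ}
    (hD : ∀ i j z s, tvDist (η i (Function.update z j s)) (η i z) ≤ D i j) :
    OscLe (glauber η f) (Matrix.vecMul δ (influenceStep D)) := by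
  intro z j s
  rw [_root_.glauber, _root_.glauber, ← smul_sub, ← Finset.sum_sub_distrib, norm_smul, norm_inv,
    Real.norm_natCast]
  calc _ ≤ (Fintype.card ι : ℝ)⁻¹ * ∑ i, ((if i = j then 0 else δ j) + D i j * δ i) := by
        gcongr
        exact norm_sum_le_of_le _ fun i _ => hδ.norm_resample_sub_le hf (hD i j z s)
    _ = _ := by
        have e : ∀ i, (if i = j then 0 else δ j) = δ j - if i = j then δ j else 0 := fun i => by
          split_ifs <;> simp
        rw [influenceStep, Matrix.vecMul_smul, Matrix.vecMul_add, Matrix.vecMul_smul,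
          Matrix.vecMul_one, Finset.sum_add_distrib]
        simp_rw [e, Finset.sum_sub_distrib]
        simp only [Finset.sum_const, Finset.card_univ, nsmul_eq_mul, Finset.sum_ite_eq',
          Finset.mem_univ, if_true, Matrix.vecMul, dotProduct, Pi.smul_apply, Pi.add_apply,
          smul_eq_mul, mul_comm (δ _)]
        ring

theorem OscLe.glauber_iterate [CompleteSpace V] {f : (ι → S) → V} {δ : ι → ℝ}
    (hδ : OscLe f δ) (hf : IsBddMeas f) {η : ι → Kernel (ι → S) S} [∀ i, IsMarkovKernel (η i)]
    {D : Matrix ι ι ℝ}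
    (hD : ∀ i j z s, tvDist (η i (Function.update z j s)) (η i z) ≤ D i j) (t : ℕ) :
    OscLe ((_root_.glauber η)^[t] f) (Matrix.vecMul δ (influenceStep D ^ t)) := by
  induction t with
  | zero => simpa using hδ
  | succ t ih =>
    rw [Function.iterate_succ_apply', pow_succ, ← Matrix.vecMul_vecMul]
    exact ih.glauber (hf.glauber_iterate η t) hD

/-- The partial sums of the Neumann series `∑ₜ glauber^t f`, normalized so that they approximate a
solution `F` of the Poisson equation `∑ i, (F - resample i F) = f`. -/
noncomputable def poissonSum (η : ι → Kernel (ι → S) S) (N : ℕ) (f : (ι → S) → V) (z : ι → S) : V :=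
  (Fintype.card ι : ℝ)⁻¹ • ∑ t ∈ Finset.range N, (glauber η)^[t] f z

theorem IsBddMeas.poissonSum {f : (ι → S) → V} (hf : IsBddMeas f)
    (η : ι → Kernel (ι → S) S) [∀ i, IsMarkovKernel (η i)] (N : ℕ) :
    IsBddMeas (poissonSum η N f) :=
  (IsBddMeas.sum fun t _ => hf.glauber_iterate η t).const_smul _

/-- `poissonSum η N f` solves the Poisson equation up to the remainder `glauber^N f`. -/
theorem sum_poissonSum_sub_resample [CompleteSpace V] [Nonempty ι] {η : ι → Kernel (ι → S) S}
    [∀ i, IsMarkovKernel (η i)] {f : (ι → S) → V} (hf : IsBddMeas f) (N : ℕ) (z : ι → S) :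
    ∑ i, (poissonSum η N f z - resample (η i) i (poissonSum η N f) z) =
      f z - (glauber η)^[N] f z := by
  have hr : ∀ i, resample (η i) i (poissonSum η N f) z =
      (Fintype.card ι : ℝ)⁻¹ • ∑ t ∈ Finset.range N, resample (η i) i ((glauber η)^[t] f) z :=
    fun i => by
      simp only [resample, poissonSum]
      rw [integral_smul, integral_finsetSum]
      exact fun t _ => ((hf.glauber_iterate η t).comp_update z i).integrable _
  have hn : (Fintype.card ι : ℝ) ≠ 0 := by positivity
  rw [Finset.sum_sub_distrib, Finset.sum_const, Finset.card_univ]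
  simp_rw [hr]
  rw [← Finset.smul_sum, Finset.sum_comm, Finset.smul_sum]
  simp_rw [← glauber.eq_def, ← Function.iterate_succ_apply' (glauber η)]
  rw [poissonSum, ← Nat.cast_smul_eq_nsmul ℝ, smul_inv_smul₀ hn, ← Finset.sum_sub_distrib,
    Finset.sum_range_sub' (fun t => (glauber η)^[t] f z)]
  rfl

end Glauber

/-! ### Row and column sums of the Neumann series -/

section Influence

variable {ι : Type*} [Fintype ι]

/-- The rate of the geometric decay of the row sums lies in `[0, 1)`. -/
theorem influenceRate_mem [Nonempty ι] {b : ℝ} (hb0 : 0 ≤ b) (hb1 : b < 1) :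
    0 ≤ 1 - (1 - b) / Fintype.card ι ∧ 1 - (1 - b) / Fintype.card ι < 1 := by
  have h : (1 : ℝ) ≤ Fintype.card ι := by exact_mod_cast Fintype.card_pos
  have h1 : (1 - b) / Fintype.card ι ≤ 1 := by rw [div_le_one (by linarith)]; linarith
  have h2 : 0 < (1 - b) / Fintype.card ι := div_pos (by linarith) (by linarith)
  constructor <;> linarith

variable [DecidableEq ι]

theorem Matrix.pow_nonneg_of_nonneg {M : Matrix ι ι ℝ} (hM : ∀ i j, 0 ≤ M i j) (t : ℕ) (i j : ι) :
    0 ≤ (M ^ t) i j := by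
  induction t generalizing j with
  | zero => rw [pow_zero, Matrix.one_apply]; positivity
  | succ t ih =>
    rw [pow_succ, Matrix.mul_apply]
    exact Finset.sum_nonneg fun k _ => mul_nonneg (ih k) (hM k j)

theorem Matrix.sum_pow_apply_le {M : Matrix ι ι ℝ} (hM : ∀ i j, 0 ≤ M i j) {r : ℝ} (hr : 0 ≤ r)
    (h : ∀ i, ∑ j, M i j ≤ r) (t : ℕ) (i : ι) : ∑ j, (M ^ t) i j ≤ r ^ t := by
  induction t with
  | zero => simp [Matrix.one_apply]
  | succ t ih =>
    simp_rw [pow_succ, Matrix.mul_apply]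
    rw [Finset.sum_comm]
    simp_rw [← Finset.mul_sum]
    calc _ ≤ ∑ k, (M ^ t) i k * r := by
          gcongr with k
          · exact Matrix.pow_nonneg_of_nonneg hM t i k
          · exact h k
      _ = (∑ k, (M ^ t) i k) * r := by rw [Finset.sum_mul]
      _ ≤ _ := by gcongr

variable {D : Matrix ι ι ℝ}

theorem influenceStep_apply (D : Matrix ι ι ℝ) (i j : ι) :
    influenceStep D i j =
      (Fintype.card ι : ℝ)⁻¹ * (((Fintype.card ι : ℝ) - 1) * (if i = j then 1 else 0) + D i j) := by
  simp [influenceStep, Matrix.one_apply]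

theorem influenceStep_nonneg [Nonempty ι] (hD : ∀ i j, 0 ≤ D i j) (i j : ι) :
    0 ≤ influenceStep D i j := by
  rw [influenceStep_apply]
  have h : (1 : ℝ) ≤ Fintype.card ι := by exact_mod_cast Fintype.card_pos
  have := hD i j
  have h2 : 0 ≤ (Fintype.card ι : ℝ) - 1 := by linarith
  positivity

theorem influenceStep_transpose : (influenceStep D).transpose = influenceStep D.transpose := by
  simp [influenceStep]

theorem sum_influenceStep_le [Nonempty ι] {b : ℝ} (hb : ∀ i, ∑ j, D i j ≤ b) (i : ι) :
    ∑ j, influenceStep D i j ≤ 1 - (1 - b) / Fintype.card ι := by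
  have h : (Fintype.card ι : ℝ) ≠ 0 := by positivity
  simp_rw [influenceStep_apply]
  rw [← Finset.mul_sum, Finset.sum_add_distrib, ← Finset.mul_sum]
  simp only [Finset.sum_ite_eq, Finset.mem_univ, if_true]
  calc _ ≤ (Fintype.card ι : ℝ)⁻¹ * (((Fintype.card ι : ℝ) - 1) * 1 + b) := by gcongr; exact hb i
    _ = _ := by field_simp; ring

/-- The partial sums of the Neumann series of `influenceStep D`, which approximate the inverse of
`1 - D` from below. -/
noncomputable def influenceSum (D : Matrix ι ι ℝ) (N : ℕ) : Matrix ι ι ℝ :=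
  (Fintype.card ι : ℝ)⁻¹ • ∑ t ∈ Finset.range N, influenceStep D ^ t

theorem influenceSum_nonneg [Nonempty ι] (hD : ∀ i j, 0 ≤ D i j) (N : ℕ) (i j : ι) :
    0 ≤ influenceSum D N i j := by
  rw [influenceSum, Matrix.smul_apply, Matrix.sum_apply, smul_eq_mul]
  exact mul_nonneg (by positivity) (Finset.sum_nonneg fun t _ =>
    Matrix.pow_nonneg_of_nonneg (influenceStep_nonneg hD) t i j)

theorem sum_influenceSum_le [Nonempty ι] (hD : ∀ i j, 0 ≤ D i j) {b : ℝ} (hb0 : 0 ≤ b)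
    (hb1 : b < 1) (hb : ∀ i, ∑ j, D i j ≤ b) (N : ℕ) (i : ι) :
    ∑ j, influenceSum D N i j ≤ 1 / (1 - b) := by
  obtain ⟨hr0, hr1⟩ := influenceRate_mem (ι := ι) hb0 hb1
  set r := 1 - (1 - b) / Fintype.card ι with hr
  have hn : (Fintype.card ι : ℝ) ≠ 0 := by positivity
  simp_rw [influenceSum, Matrix.smul_apply, Matrix.sum_apply, smul_eq_mul]
  rw [← Finset.mul_sum, Finset.sum_comm]
  calc _ ≤ (Fintype.card ι : ℝ)⁻¹ * ∑ t ∈ Finset.range N, r ^ t := by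
        gcongr with t
        exact Matrix.sum_pow_apply_le (influenceStep_nonneg hD) hr0 (sum_influenceStep_le hb) t i
    _ ≤ (Fintype.card ι : ℝ)⁻¹ * (1 - r)⁻¹ := by
        gcongr
        rw [← tsum_geometric_of_lt_one hr0 hr1]
        exact (summable_geometric_of_lt_one hr0 hr1).sum_le_tsum _ fun t _ => pow_nonneg hr0 t
    _ = _ := by
        rw [hr, sub_sub_cancel, inv_div, one_div]
        field_simp

theorem influenceSum_transpose (N : ℕ) :
    (influenceSum D N).transpose = influenceSum D.transpose N := by
  simp [influenceSum, Matrix.transpose_sum, Matrix.transpose_pow, influenceStep_transpose]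

end Influence

/-! ### Exchangeable pairs -/

theorem integral_compProd_fst {α β V : Type*} [MeasurableSpace α] [MeasurableSpace β]
    [NormedAddCommGroup V] [NormedSpace ℝ V] [CompleteSpace V] {π : Measure α}
    [IsProbabilityMeasure π] {κ : Kernel α β} [IsMarkovKernel κ] {g : α → V} (hg : IsBddMeas g) :
    ∫ p, g p.1 ∂π.compProd κ = ∫ z, g z ∂π := by
  rw [Measure.integral_compProd ((hg.comp measurable_fst).integrable _)]
  simp

section Exchangeable

variable {ι S V : Type*} [DecidableEq ι] [MeasurableSpace S]

/-- The law of the pair `(z, z')`, where `z` has law `π` and `z'` arises from `z` by resampling the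
`i`-th coordinate from `κ z`. -/
noncomputable def resamplePair (π : Measure (ι → S)) (κ : Kernel (ι → S) S) (i : ι) :
    Measure ((ι → S) × (ι → S)) :=
  (π.compProd κ).map fun p => (p.1, Function.update p.1 i p.2)

/-- `κ` is a reversible rule for resampling the `i`-th coordinate: the states before and after the
resampling are exchangeable. -/
def IsReversibleResample (π : Measure (ι → S)) (κ : Kernel (ι → S) S) (i : ι) : Prop :=
  (resamplePair π κ i).map Prod.swap = resamplePair π κ i

variable {π : Measure (ι → S)} {κ : Kernel (ι → S) S} {i : ι} [NormedAddCommGroup V]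
  [NormedSpace ℝ V]

theorem integral_resamplePair {h : (ι → S) × (ι → S) → V} (hh : StronglyMeasurable h) :
    ∫ q, h q ∂resamplePair π κ i =
      ∫ p, h (p.1, Function.update p.1 i p.2) ∂π.compProd κ :=
  integral_map (measurable_fst.prodMk (measurable_update_prod i)).aemeasurable
    hh.aestronglyMeasurable

theorem IsReversibleResample.integral_swap (hrev : IsReversibleResample π κ i)
    {h : (ι → S) × (ι → S) → V} (hh : StronglyMeasurable h) :
    ∫ p, h (Function.update p.1 i p.2, p.1) ∂π.compProd κ =
      ∫ p, h (p.1, Function.update p.1 i p.2) ∂π.compProd κ := by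
  have h2 : ∫ q, h q.swap ∂resamplePair π κ i =
      ∫ p, h (Function.update p.1 i p.2, p.1) ∂π.compProd κ :=
    integral_resamplePair (hh.comp_measurable measurable_swap)
  rw [← h2, ← integral_resamplePair hh]
  conv_rhs => rw [← show _ = _ from hrev]
  exact (integral_map measurable_swap.aemeasurable hh.aestronglyMeasurable).symm

variable [IsProbabilityMeasure π] [IsMarkovKernel κ] [CompleteSpace V]

theorem IsReversibleResample.integral_update (hrev : IsReversibleResample π κ i)
    {g : (ι → S) → V} (hg : IsBddMeas g) :
    ∫ p, g (Function.update p.1 i p.2) ∂π.compProd κ = ∫ z, g z ∂π := by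
  rw [← integral_compProd_fst (κ := κ) hg]
  exact hrev.integral_swap (h := fun q => g q.1)
    (hg.stronglyMeasurable.comp_measurable measurable_fst)

theorem IsReversibleResample.integral_resample (hrev : IsReversibleResample π κ i)
    {g : (ι → S) → V} (hg : IsBddMeas g) :
    ∫ z, resample κ i g z ∂π = ∫ z, g z ∂π := by
  rw [← hrev.integral_update hg,
    Measure.integral_compProd ((hg.comp (measurable_update_prod i)).integrable _)]
  rfl

theorem integral_glauber_iterate [Fintype ι] [Nonempty ι] {η : ι → Kernel (ι → S) S}
    [∀ i, IsMarkovKernel (η i)] (hrev : ∀ i, IsReversibleResample π (η i) i) {g : (ι → S) → V}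
    (hg : IsBddMeas g) (t : ℕ) : ∫ z, (glauber η)^[t] g z ∂π = ∫ z, g z ∂π := by
  induction t with
  | zero => rfl
  | succ t ih =>
    have h := hg.glauber_iterate η t
    rw [Function.iterate_succ_apply', ← ih]
    simp only [glauber]
    rw [integral_smul, integral_finsetSum _ fun i _ => (h.resample (η i) i).integrable _]
    simp_rw [fun i => (hrev i).integral_resample h]
    rw [Finset.sum_const, Finset.card_univ, ← Nat.cast_smul_eq_nsmul ℝ, inv_smul_smul₀]
    positivity

end Exchangeable

section MatrixExchangeable

open scoped Matrix.Norms.L2Operator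

variable {d : ℕ}

local notation "op" => Matrix.toEuclideanCLM (𝕜 := ℂ)

/-- The real part of the trace, as a continuous real-linear functional. -/
noncomputable def reTrace (d : ℕ) : Matrix (Fin d) (Fin d) ℂ →L[ℝ] ℝ :=
  LinearMap.toContinuousLinearMap (Complex.reLm ∘ₗ Matrix.traceLinearMap (Fin d) ℝ ℂ)

theorem reTrace_apply (M : Matrix (Fin d) (Fin d) ℂ) : reTrace d M = M.trace.re := rfl

/-- Evaluation of a matrix at a vector, as a continuous real-linear map. -/
noncomputable def evalAt (v : EuclideanSpace ℂ (Fin d)) :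
    Matrix (Fin d) (Fin d) ℂ →L[ℝ] EuclideanSpace ℂ (Fin d) :=
  LinearMap.toContinuousLinearMap
    (((LinearMap.applyₗ v).comp (Matrix.toEuclideanLin (𝕜 := ℂ)).toLinearMap).restrictScalars ℝ)

theorem evalAt_apply (v : EuclideanSpace ℂ (Fin d)) (M : Matrix (Fin d) (Fin d) ℂ) :
    evalAt v M = op M v := rfl

section

variable {α : Type*} [MeasurableSpace α] {f g : α → Matrix (Fin d) (Fin d) ℂ}

theorem IsBddMeas.matrix_mul (hf : IsBddMeas f) (hg : IsBddMeas g) :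
    IsBddMeas fun x => f x * g x := by
  obtain ⟨C, hC⟩ := hf.bdd
  obtain ⟨C', hC'⟩ := hg.bdd
  refine ⟨hf.stronglyMeasurable.mul hg.stronglyMeasurable, C * C', fun x => ?_⟩
  exact (norm_mul_le _ _).trans (mul_le_mul (hC x) (hC' x) (norm_nonneg _)
    ((norm_nonneg _).trans (hC x)))

theorem IsBddMeas.re_trace (hf : IsBddMeas f) : IsBddMeas fun x => (f x).trace.re :=
  hf.clm_comp (reTrace d)

theorem IsBddMeas.exp_smul (hf : IsBddMeas f) (θ : ℝ) :
    IsBddMeas fun x => NormedSpace.exp (θ • f x) := by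
  have hcont : Continuous fun M : Matrix (Fin d) (Fin d) ℂ => NormedSpace.exp (θ • M) := by
    let _ := NormedAlgebra.restrictScalars ℚ ℝ (Matrix (Fin d) (Fin d) ℂ)
    exact NormedSpace.exp_continuous.comp (continuous_const_smul θ)
  obtain ⟨C, hC⟩ := hf.bdd
  have : ProperSpace (Matrix (Fin d) (Fin d) ℂ) := FiniteDimensional.proper_real _
  obtain ⟨C', hC'⟩ := (isCompact_closedBall (0 : Matrix (Fin d) (Fin d) ℂ) C
    ).exists_bound_of_continuousOn hcont.continuousOn
  exact ⟨hcont.comp_stronglyMeasurable hf.stronglyMeasurable, C',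
    fun x => hC' _ (mem_closedBall_zero_iff.2 (hC x))⟩

end

variable {ι S : Type*} [DecidableEq ι] [MeasurableSpace S] {π : Measure (ι → S)}
  [IsProbabilityMeasure π] {κ : Kernel (ι → S) S} [IsMarkovKernel κ] {i : ι}

/-- Exchangeability turns the Dirichlet form of a reversible resampling into a symmetric
expression. -/
theorem IsReversibleResample.integral_sub_resample_mul (hrev : IsReversibleResample π κ i)
    {F Φ : (ι → S) → Matrix (Fin d) (Fin d) ℂ} (hF : IsBddMeas F) (hΦ : IsBddMeas Φ) :
    ∫ z, ((F z - resample κ i F z) * Φ z).trace.re ∂π =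
      (∫ p, ((F p.1 - F (Function.update p.1 i p.2)) *
        (Φ p.1 - Φ (Function.update p.1 i p.2))).trace.re ∂π.compProd κ) / 2 := by
  have hF1 : IsBddMeas fun p : (ι → S) × S => F p.1 := hF.comp measurable_fst
  have hF2 := hF.comp (measurable_update_prod (S := S) i)
  have hΦ1 : IsBddMeas fun p : (ι → S) × S => Φ p.1 := hΦ.comp measurable_fst
  have hΦ2 := hΦ.comp (measurable_update_prod (S := S) i)
  have e1 : ∫ z, ((F z - resample κ i F z) * Φ z).trace.re ∂π =
      ∫ p, ((F p.1 - F (Function.update p.1 i p.2)) * Φ p.1).trace.re ∂π.compProd κ := by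
    rw [Measure.integral_compProd (((hF1.sub hF2).matrix_mul hΦ1).re_trace.integrable _)]
    congr 1
    ext z
    -- for fixed `z`, the integrand is a continuous linear function of the resampled value of `F`
    have h := ((reTrace d).comp ((ContinuousLinearMap.mul ℝ
      (Matrix (Fin d) (Fin d) ℂ)).flip (Φ z))).integral_comp_comm
      ((integrable_const (F z)).sub ((hF.comp_update z i).integrable (κ z)))
    simp only [ContinuousLinearMap.comp_apply, ContinuousLinearMap.flip_apply,
      ContinuousLinearMap.mul_apply', reTrace_apply, Pi.sub_apply] at h
    rw [h, integral_sub (integrable_const _) ((hF.comp_update z i).integrable _)]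
    simp [_root_.resample]
  have hq : StronglyMeasurable fun q : (ι → S) × (ι → S) => ((F q.1 - F q.2) * Φ q.1).trace.re :=
    (((hF.comp measurable_fst).sub (hF.comp measurable_snd)).matrix_mul
      (hΦ.comp measurable_fst)).re_trace.stronglyMeasurable
  have e2 := hrev.integral_swap hq
  have e3 : ∀ p : (ι → S) × S, ((F p.1 - F (Function.update p.1 i p.2)) *
      (Φ p.1 - Φ (Function.update p.1 i p.2))).trace.re =
      ((F p.1 - F (Function.update p.1 i p.2)) * Φ p.1).trace.re +
      ((F (Function.update p.1 i p.2) - F p.1) * Φ (Function.update p.1 i p.2)).trace.re :=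
    fun p => by
      rw [← Complex.add_re, ← Matrix.trace_add]
      congr 2
      noncomm_ring
  simp_rw [e3]
  rw [integral_add (((hF1.sub hF2).matrix_mul hΦ1).re_trace.integrable _)
    (((hF2.sub hF1).matrix_mul hΦ2).re_trace.integrable _), e2, e1]
  ring

end MatrixExchangeable

/-! ### Growth of the trace moment generating function -/

section Growth

open scoped Matrix.Norms.L2Operator

local notation "op" => Matrix.toEuclideanCLM (𝕜 := ℂ)

variable {d : ℕ}

theorem Matrix.IsHermitian.re_inner_sq {A : Matrix (Fin d) (Fin d) ℂ} (hA : A.IsHermitian)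
    (v : EuclideanSpace ℂ (Fin d)) : (inner ℂ v (op (A ^ 2) v)).re = ‖op A v‖ ^ 2 := by
  rw [pow_two, map_mul, mul_apply_eq_comp]
  have h : inner ℂ v (op A (op A v)) = inner ℂ (op A v) (op A v) :=
    (hA.isSymmetric_toEuclideanCLM v (op A v)).symm
  rw [h, inner_self_eq_norm_sq_to_K]
  norm_cast

theorem Matrix.l2_opNorm_le_of_forall {M : Matrix (Fin d) (Fin d) ℂ} {C : ℝ} (hC : 0 ≤ C)
    (h : ∀ v, ‖op M v‖ ≤ C * ‖v‖) : ‖M‖ ≤ C := by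
  rw [← Matrix.l2_opNorm_toEuclideanCLM]
  exact (op M).opNorm_le_bound hC h

/-- The setting of the concentration inequality: a measure `π` on a product space, with reversible
resampling kernels `η i` that satisfy Dobrushin's condition with matrix `D`, and centred Hermitian
functions `f k` of the single coordinates, with `f k ^ 2` dominated by `A k ^ 2`. The bounds are
required everywhere, not just almost everywhere. For a Hermitian matrix `M`, the Loewner bound
`M ^ 2 ≤ A ^ 2` is encoded as `‖M v‖ ≤ ‖A v‖` for all vectors `v`: in this form it passes to
integrals and sums by the triangle inequality. -/
structure DobrushinSystem {ι S : Type*} [Fintype ι] [DecidableEq ι] [MeasurableSpace S]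
    (π : Measure (ι → S)) (η : ι → Kernel (ι → S) S) (D : Matrix ι ι ℝ)
    (f : ι → S → Matrix (Fin d) (Fin d) ℂ) (A : ι → Matrix (Fin d) (Fin d) ℂ) : Prop where
  reversible : ∀ i, IsReversibleResample π (η i) i
  nonneg : ∀ i j, 0 ≤ D i j
  tv_le : ∀ i j z s, tvDist (η i (Function.update z j s)) (η i z) ≤ D i j
  stronglyMeasurable : ∀ k, StronglyMeasurable (f k)
  isHermitian : ∀ k s, (f k s).IsHermitian
  isHermitian_bound : ∀ k, (A k).IsHermitian
  norm_le : ∀ k s v, ‖op (f k s) v‖ ≤ ‖op (A k) v‖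
  mean_zero : ∀ k, ∫ z, f k (z k) ∂π = 0

namespace DobrushinSystem

variable {ι S : Type*} [Fintype ι] [DecidableEq ι] [MeasurableSpace S] {π : Measure (ι → S)}
  {η : ι → Kernel (ι → S) S} {D : Matrix ι ι ℝ} {f : ι → S → Matrix (Fin d) (Fin d) ℂ}
  {A : ι → Matrix (Fin d) (Fin d) ℂ}

theorem isBddMeas (h : DobrushinSystem π η D f A) (k : ι) :
    IsBddMeas fun z : ι → S => f k (z k) := by
  refine ⟨(h.stronglyMeasurable k).comp_measurable (measurable_pi_apply k), ‖A k‖, fun z => ?_⟩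
  exact Matrix.l2_opNorm_le_of_forall (norm_nonneg _) fun v =>
    (h.norm_le k _ v).trans (Matrix.norm_toEuclideanCLM_apply_le _ v)

theorem isBddMeas_sum (h : DobrushinSystem π η D f A) :
    IsBddMeas fun z : ι → S => ∑ k, f k (z k) :=
  IsBddMeas.sum fun k _ => h.isBddMeas k

theorem norm_sub_le_two_mul (h : DobrushinSystem π η D f A) (k : ι) (s s' : S)
    (v : EuclideanSpace ℂ (Fin d)) : ‖op (f k s - f k s') v‖ ≤ 2 * ‖op (A k) v‖ := by
  rw [map_sub, sub_apply]
  linarith [_root_.norm_sub_le (op (f k s) v) (op (f k s') v), h.norm_le k s v, h.norm_le k s' v]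

theorem isHermitian_sum (h : DobrushinSystem π η D f A) (z : ι → S) :
    (∑ k, f k (z k)).IsHermitian :=
  isSelfAdjoint_sum _ fun k _ => h.isHermitian k _

theorem sum_norm_sq_le (h : DobrushinSystem π η D f A) (v : EuclideanSpace ℂ (Fin d)) :
    ∑ k, ‖op (A k) v‖ ^ 2 ≤ ‖∑ k, A k ^ 2‖ * ‖v‖ ^ 2 := by
  refine le_trans (le_of_eq ?_) ((le_abs_self _).trans (Matrix.abs_re_inner_le _ v))
  rw [map_sum, sum_apply, inner_sum, Complex.re_sum]
  exact Finset.sum_congr rfl fun k _ => ((h.isHermitian_bound k).re_inner_sq v).symm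

/-- A change of the `i`-th coordinate shifts the sum by a matrix whose square is at most
`4 A i ^ 2` in the Loewner order. -/
theorem norm_sum_sub_update_le (h : DobrushinSystem π η D f A) (z : ι → S) (i : ι) (u : S)
    (v : EuclideanSpace ℂ (Fin d)) :
    ‖op (∑ k, f k (z k) - ∑ k, f k (Function.update z i u k)) v‖ ≤ 2 * ‖op (A i) v‖ := by
  have : ∑ k, f k (z k) - ∑ k, f k (Function.update z i u k) = f i (z i) - f i u := by
    rw [← Finset.sum_sub_distrib, Finset.sum_eq_single i]
    · rw [Function.update_self]
    · intro k _ hk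
      rw [Function.update_of_ne hk, sub_self]
    · simp
  rw [this]
  exact h.norm_sub_le_two_mul i _ _ v

/-- Up to the factor `4 θ`, the matrix that dominates the squares in the mean value trace inequality
when the `i`-th coordinate is resampled: the first summand accounts for the change of
`∑ k, f k (z k)`, the second one for the change of its Poisson sums. -/
noncomputable def proxy (D : Matrix ι ι ℝ) (A : ι → Matrix (Fin d) (Fin d) ℂ) (N : ℕ) (α : ℝ)
    (i : ι) : Matrix (Fin d) (Fin d) ℂ :=
  α • A i ^ 2 + ∑ k, influenceSum D N k i • A k ^ 2

theorem re_inner_proxy (h : DobrushinSystem π η D f A) (N : ℕ) (α : ℝ) (i : ι)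
    (v : EuclideanSpace ℂ (Fin d)) : (inner ℂ v (op (proxy D A N α i) v)).re =
      α * ‖op (A i) v‖ ^ 2 + ∑ k, influenceSum D N k i * ‖op (A k) v‖ ^ 2 := by
  have hs : ∀ (c : ℝ) k, (inner ℂ v (op (c • A k ^ 2) v)).re = c * ‖op (A k) v‖ ^ 2 := fun c k => by
    rw [← Complex.coe_smul, map_smul, smul_apply, inner_smul_right, Complex.re_ofReal_mul,
      (h.isHermitian_bound k).re_inner_sq]
  rw [proxy, map_add, map_sum, add_apply, sum_apply, inner_add_right, inner_sum, Complex.add_re,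
    Complex.re_sum, hs]
  simp_rw [hs]

theorem re_inner_sum_proxy_le [Nonempty ι] (h : DobrushinSystem π η D f A) {N : ℕ} {α β : ℝ}
    (hα : 0 ≤ α) (hβ : ∀ k, ∑ i, influenceSum D N k i ≤ β) (v : EuclideanSpace ℂ (Fin d)) :
    (inner ℂ v (op (∑ i, proxy D A N α i) v)).re ≤
      (α + β) * ‖∑ k, A k ^ 2‖ * ‖v‖ ^ 2 := by
  have hαβ : 0 ≤ α + β := add_nonneg hα <| le_trans
    (Finset.sum_nonneg fun i _ => influenceSum_nonneg h.nonneg N (Classical.arbitrary ι) i) (hβ _)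
  rw [map_sum, sum_apply, inner_sum, Complex.re_sum]
  simp_rw [h.re_inner_proxy]
  rw [Finset.sum_add_distrib, Finset.sum_comm]
  simp_rw [← Finset.sum_mul]
  calc _ ≤ ∑ i, α * ‖op (A i) v‖ ^ 2 + ∑ k, β * ‖op (A k) v‖ ^ 2 := by
        gcongr with k
        exact hβ k
    _ = (α + β) * ∑ k, ‖op (A k) v‖ ^ 2 := by rw [← Finset.mul_sum, ← Finset.mul_sum, add_mul]
    _ ≤ (α + β) * (‖∑ k, A k ^ 2‖ * ‖v‖ ^ 2) := by gcongr; exact h.sum_norm_sq_le v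
    _ = _ := by ring

variable [∀ i, IsMarkovKernel (η i)]

theorem oscLe_glauber_iterate (h : DobrushinSystem π η D f A) (k : ι) (t : ℕ)
    (v : EuclideanSpace ℂ (Fin d)) :
    OscLe (fun z => op ((glauber η)^[t] (fun z => f k (z k)) z) v)
      (fun j => 2 * ‖op (A k) v‖ * (influenceStep D ^ t) k j) := by
  have h0 : OscLe (fun z : ι → S => evalAt v (f k (z k))) (Pi.single k (2 * ‖op (A k) v‖)) := by
    intro z j s
    rw [← map_sub]
    rcases eq_or_ne k j with rfl | hkj
    · rw [Pi.single_eq_same]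
      exact h.norm_sub_le_two_mul k _ _ v
    · rw [Function.update_of_ne hkj, sub_self, map_zero, norm_zero, Pi.single_eq_of_ne hkj.symm]
  have h1 := h0.glauber_iterate ((h.isBddMeas k).clm_comp (evalAt v)) h.tv_le t
  rw [Matrix.single_vecMul] at h1
  intro z j s
  have h2 := h1 z j s
  rw [← clm_glauber_iterate (evalAt v) (h.isBddMeas k), ← clm_glauber_iterate (evalAt v)
    (h.isBddMeas k)] at h2
  exact h2

theorem norm_poissonSum_sub_update_le [Nonempty ι] (h : DobrushinSystem π η D f A) (k : ι) (N : ℕ)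
    (z : ι → S) (i : ι) (u : S) (v : EuclideanSpace ℂ (Fin d)) :
    ‖op (poissonSum η N (fun z => f k (z k)) z -
      poissonSum η N (fun z => f k (z k)) (Function.update z i u)) v‖ ≤
        2 * ‖op (A k) v‖ * influenceSum D N k i := by
  have e : ∀ M, op M v = evalAt v M := fun _ => rfl
  rw [poissonSum, poissonSum, ← smul_sub, ← Finset.sum_sub_distrib, e, map_smul, map_sum,
    norm_smul, norm_inv, Real.norm_natCast, influenceSum, Matrix.smul_apply, Matrix.sum_apply,
    smul_eq_mul, mul_left_comm, Finset.mul_sum]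
  gcongr
  refine norm_sum_le_of_le _ fun t _ => ?_
  have := h.oscLe_glauber_iterate k t v z i u
  rw [norm_sub_rev] at this
  rw [map_sub]
  exact this

/-- The square of the change of the Poisson sums is controlled by the Cauchy-Schwarz
inequality with weights `influenceSum D N k i`. -/
theorem norm_sq_sum_poissonSum_sub_update_le [Nonempty ι] (h : DobrushinSystem π η D f A) {α : ℝ}
    {N : ℕ} {i : ι} (hα : ∑ k, influenceSum D N k i ≤ α) (z : ι → S) (u : S)
    (v : EuclideanSpace ℂ (Fin d)) :
    ‖op (∑ k, (poissonSum η N (fun z => f k (z k)) z -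
      poissonSum η N (fun z => f k (z k)) (Function.update z i u))) v‖ ^ 2 ≤
        4 * α * ∑ k, influenceSum D N k i * ‖op (A k) v‖ ^ 2 := by
  have hw : ∀ k, 0 ≤ influenceSum D N k i := fun k => influenceSum_nonneg h.nonneg N k i
  have h1 : ‖op (∑ k, (poissonSum η N (fun z => f k (z k)) z -
      poissonSum η N (fun z => f k (z k)) (Function.update z i u))) v‖ ≤
        ∑ k, 2 * ‖op (A k) v‖ * influenceSum D N k i := by
    rw [map_sum, sum_apply]
    exact norm_sum_le_of_le _ fun k _ => h.norm_poissonSum_sub_update_le k N z i u v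
  calc _ ≤ (∑ k, 2 * ‖op (A k) v‖ * influenceSum D N k i) ^ 2 := by gcongr
    _ ≤ (∑ k, influenceSum D N k i) *
        ∑ k, 4 * (influenceSum D N k i * ‖op (A k) v‖ ^ 2) := by
        refine Finset.sum_sq_le_sum_mul_sum_of_sq_le_mul _ (fun k _ => hw k)
          (fun k _ => by have := hw k; positivity) fun k _ => le_of_eq (by ring)
    _ ≤ α * ∑ k, 4 * (influenceSum D N k i * ‖op (A k) v‖ ^ 2) := by
        gcongr
        exact Finset.sum_nonneg fun k _ => by have := hw k; positivity
    _ = _ := by rw [← Finset.mul_sum]; ring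

theorem isHermitian_glauber_iterate (h : DobrushinSystem π η D f A) (k : ι) (t : ℕ) (z : ι → S) :
    ((glauber η)^[t] (fun z => f k (z k)) z).IsHermitian := by
  have h1 := clm_glauber_iterate (η := η)
    (starL' ℝ : Matrix (Fin d) (Fin d) ℂ ≃L[ℝ] Matrix (Fin d) (Fin d) ℂ).toContinuousLinearMap
    (h.isBddMeas k) t z
  have h2 : (fun z : ι → S => (starL' ℝ : Matrix (Fin d) (Fin d) ℂ ≃L[ℝ]
      Matrix (Fin d) (Fin d) ℂ).toContinuousLinearMap (f k (z k))) = fun z => f k (z k) :=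
    funext fun z => h.isHermitian k (z k)
  rw [h2] at h1
  exact h1

theorem isHermitian_poissonSum (h : DobrushinSystem π η D f A) (k : ι) (N : ℕ) (z : ι → S) :
    (poissonSum η N (fun z => f k (z k)) z).IsHermitian :=
  IsSelfAdjoint.smul (IsSelfAdjoint.all _)
    (isSelfAdjoint_sum _ fun t _ => h.isHermitian_glauber_iterate k t z)

variable [IsProbabilityMeasure π]

/-- The Glauber dynamics forgets its starting point exponentially fast: the oscillation decays, and
the mean remains zero. -/
theorem norm_glauber_iterate_le [Nonempty ι] (h : DobrushinSystem π η D f A) {b : ℝ}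
    (hb0 : 0 ≤ b) (hb1 : b < 1) (hb : ∀ i, ∑ j, D i j ≤ b) (k : ι) (t : ℕ) (z : ι → S) :
    ‖(glauber η)^[t] (fun z => f k (z k)) z‖ ≤
      2 * ‖A k‖ * (1 - (1 - b) / Fintype.card ι) ^ t := by
  have hr := (influenceRate_mem (ι := ι) hb0 hb1).1
  set g := (glauber η)^[t] (fun z => f k (z k)) with hg_def
  have hg : IsBddMeas g := (h.isBddMeas k).glauber_iterate η t
  refine Matrix.l2_opNorm_le_of_forall (by positivity) fun v => ?_
  have hmean : ∫ y, evalAt v (g y) ∂π = 0 := by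
    rw [(evalAt v).integral_comp_comm (hg.integrable π),
      integral_glauber_iterate h.reversible (h.isBddMeas k), h.mean_zero, map_zero]
  have h1 : op (g z) v = ∫ y, (evalAt v (g z) - evalAt v (g y)) ∂π := by
    rw [integral_sub (integrable_const _) ((hg.clm_comp (evalAt v)).integrable π), hmean]
    simp [evalAt_apply]
  rw [h1]
  refine (norm_integral_le_of_norm_le_const (C := 2 * ‖op (A k) v‖ *
    (1 - (1 - b) / Fintype.card ι) ^ t) (ae_of_all _ fun y => ?_)).trans ?_
  · refine ((h.oscLe_glauber_iterate k t v).norm_sub_le z y).trans ?_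
    rw [← Finset.mul_sum]
    gcongr
    exact Matrix.sum_pow_apply_le (influenceStep_nonneg h.nonneg) hr (sum_influenceStep_le hb) t k
  · rw [probReal_univ, mul_one]
    calc _ ≤ 2 * (‖A k‖ * ‖v‖) * (1 - (1 - b) / Fintype.card ι) ^ t := by
          gcongr
          exact Matrix.norm_toEuclideanCLM_apply_le _ _
      _ = _ := by ring

/-- The contribution of the resampling of the `i`-th coordinate to the growth of the trace moment
generating function. -/
theorem integral_sub_update_mul_le [Nonempty ι] (h : DobrushinSystem π η D f A) {N : ℕ} {α : ℝ}
    (hα0 : 0 < α) {i : ι} (hα : ∑ k, influenceSum D N k i ≤ α) {θ : ℝ} (hθ : 0 < θ) :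
    (∫ p, ((∑ k, (poissonSum η N (fun z => f k (z k)) p.1 -
        poissonSum η N (fun z => f k (z k)) (Function.update p.1 i p.2))) *
      (NormedSpace.exp (θ • ∑ k, f k (p.1 k)) -
        NormedSpace.exp (θ • ∑ k, f k (Function.update p.1 i p.2 k)))).trace.re
          ∂π.compProd (η i)) / 2 ≤
      θ * ∫ z, (proxy D A N α i * NormedSpace.exp (θ • ∑ k, f k (z k))).trace.re ∂π := by
  set Φ : (ι → S) → Matrix (Fin d) (Fin d) ℂ := fun z => NormedSpace.exp (θ • ∑ k, f k (z k))
  have hΦ : IsBddMeas Φ := h.isBddMeas_sum.exp_smul θ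
  have hconst : ∀ {β : Type _} [MeasurableSpace β] (M : Matrix (Fin d) (Fin d) ℂ),
      IsBddMeas fun _ : β => M := fun M => ⟨stronglyMeasurable_const, ‖M‖, fun _ => le_rfl⟩
  have hQ : IsBddMeas fun z => (proxy D A N α i * Φ z).trace.re :=
    ((hconst _).matrix_mul hΦ).re_trace
  have hQ1 : IsBddMeas fun p : (ι → S) × S => (proxy D A N α i * Φ p.1).trace.re :=
    hQ.comp measurable_fst
  have hQ2 := hQ.comp (measurable_update_prod (S := S) i)
  have hF : ∀ k, IsBddMeas (poissonSum η N (fun z => f k (z k))) := fun k =>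
    (h.isBddMeas k).poissonSum η N
  have hL : IsBddMeas fun p : (ι → S) × S => ((∑ k, (poissonSum η N (fun z => f k (z k)) p.1 -
      poissonSum η N (fun z => f k (z k)) (Function.update p.1 i p.2))) *
        (Φ p.1 - Φ (Function.update p.1 i p.2))).trace.re :=
    ((IsBddMeas.sum fun k _ => ((hF k).comp measurable_fst).sub
      ((hF k).comp (measurable_update_prod i))).matrix_mul
        ((hΦ.comp measurable_fst).sub (hΦ.comp (measurable_update_prod i)))).re_trace
  have key : ∀ p : (ι → S) × S, ((∑ k, (poissonSum η N (fun z => f k (z k)) p.1 -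
      poissonSum η N (fun z => f k (z k)) (Function.update p.1 i p.2))) *
        (Φ p.1 - Φ (Function.update p.1 i p.2))).trace.re ≤
      θ * ((proxy D A N α i * Φ p.1).trace.re +
        (proxy D A N α i * Φ (Function.update p.1 i p.2)).trace.re) := fun p => by
    -- the weight `α / θ` balances the two squares
    have hmv := Matrix.re_trace_mul_exp_sub_exp_le (h.isHermitian_sum p.1)
      (h.isHermitian_sum (Function.update p.1 i p.2))
      (C := ∑ k, (poissonSum η N (fun z => f k (z k)) p.1 -
        poissonSum η N (fun z => f k (z k)) (Function.update p.1 i p.2)))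
      (isSelfAdjoint_sum _ fun k _ => IsSelfAdjoint.sub (h.isHermitian_poissonSum k N p.1)
        (h.isHermitian_poissonSum k N _)) θ (div_pos hα0 hθ) (Q := (4 * θ) • proxy D A N α i)
      fun v => ?_
    · refine hmv.trans (le_of_eq ?_)
      simp only [Matrix.smul_mul, Matrix.trace_smul, Complex.smul_re, smul_eq_mul, Φ]
      ring
    · have h1 := h.norm_sum_sub_update_le p.1 i p.2 v
      have h2 := h.norm_sq_sum_poissonSum_sub_update_le hα p.1 p.2 v
      rw [← Complex.coe_smul, map_smul, smul_apply, inner_smul_right, Complex.re_ofReal_mul,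
        h.re_inner_proxy]
      calc _ ≤ α / θ * (θ ^ 2 * (2 * ‖op (A i) v‖) ^ 2) +
            (α / θ)⁻¹ * (4 * α * ∑ k, influenceSum D N k i * ‖op (A k) v‖ ^ 2) := by gcongr
        _ = _ := by
          field_simp
          ring
  calc _ ≤ (∫ p, θ * ((proxy D A N α i * Φ p.1).trace.re +
        (proxy D A N α i * Φ (Function.update p.1 i p.2)).trace.re) ∂π.compProd (η i)) / 2 := by
        gcongr ?_ / 2
        exact integral_mono (hL.integrable _) ((hQ1.add hQ2).const_smul θ |>.integrable _) key
    _ = _ := by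
        rw [integral_const_mul, integral_add (hQ1.integrable _) (hQ2.integrable _),
          integral_compProd_fst hQ, (h.reversible i).integral_update hQ]
        ring

/-- The derivative of the trace moment generating function at `θ` is at most
`θ (α + β) ‖∑ A k ^ 2‖` times its value. -/
theorem integral_sum_mul_exp_le [Nonempty ι] (h : DobrushinSystem π η D f A) {a b : ℝ}
    (ha0 : 0 ≤ a) (ha1 : a < 1) (ha : ∀ j, ∑ i, D i j ≤ a)
    (hb0 : 0 ≤ b) (hb1 : b < 1) (hb : ∀ i, ∑ j, D i j ≤ b) {θ : ℝ} (hθ : 0 < θ) :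
    ∫ z, ((∑ k, f k (z k)) * NormedSpace.exp (θ • ∑ k, f k (z k))).trace.re ∂π ≤
      θ * ((1 / (1 - a) + 1 / (1 - b)) * ‖∑ k, A k ^ 2‖) *
        ∫ z, (NormedSpace.exp (θ • ∑ k, f k (z k))).trace.re ∂π := by
  set Φ : (ι → S) → Matrix (Fin d) (Fin d) ℂ := fun z => NormedSpace.exp (θ • ∑ k, f k (z k))
    with hΦ_def
  have hΦ : IsBddMeas Φ := h.isBddMeas_sum.exp_smul θ
  have hΦt := hΦ.re_trace
  have hα0 : 0 < 1 / (1 - a) := one_div_pos.2 (by linarith)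
  set α := 1 / (1 - a)
  set β := 1 / (1 - b)
  set r := 1 - (1 - b) / Fintype.card ι
  obtain ⟨hr0, hr1⟩ := influenceRate_mem (ι := ι) hb0 hb1
  have hconst : ∀ M : Matrix (Fin d) (Fin d) ℂ, IsBddMeas fun _ : ι → S => M := fun M =>
    ⟨stronglyMeasurable_const, ‖M‖, fun _ => le_rfl⟩
  have bound : ∀ N : ℕ, ∫ z, ((∑ k, f k (z k)) * Φ z).trace.re ∂π ≤
      (θ * ((α + β) * ‖∑ k, A k ^ 2‖) + (∑ k, 2 * ‖A k‖) * r ^ N) *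
        ∫ z, (Φ z).trace.re ∂π := by
    intro N
    have hα : ∀ i, ∑ k, influenceSum D N k i ≤ α := fun i => by
      have := sum_influenceSum_le (D := D.transpose) (fun i j => h.nonneg j i) ha0 ha1 ha N i
      rwa [← influenceSum_transpose] at this
    have hβ : ∀ k, ∑ i, influenceSum D N k i ≤ β := sum_influenceSum_le h.nonneg hb0 hb1 hb N
    set R : ι → (ι → S) → Matrix (Fin d) (Fin d) ℂ := fun k => (glauber η)^[N] fun z => f k (z k)
    set F : ι → (ι → S) → Matrix (Fin d) (Fin d) ℂ := fun k => poissonSum η N fun z => f k (z k)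
    have hR : ∀ k, IsBddMeas (R k) := fun k => (h.isBddMeas k).glauber_iterate η N
    have hF : ∀ k, IsBddMeas (F k) := fun k => (h.isBddMeas k).poissonSum η N
    have hFr : ∀ k i, IsBddMeas fun z => ((F k z - resample (η i) i (F k) z) * Φ z).trace.re :=
      fun k i => (((hF k).sub ((hF k).resample (η i) i)).matrix_mul hΦ).re_trace
    have hFd : ∀ k i, IsBddMeas fun p : (ι → S) × S =>
        ((F k p.1 - F k (Function.update p.1 i p.2)) *
          (Φ p.1 - Φ (Function.update p.1 i p.2))).trace.re := fun k i =>
      ((((hF k).comp measurable_fst).sub ((hF k).comp (measurable_update_prod i))).matrix_mul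
        ((hΦ.comp measurable_fst).sub (hΦ.comp (measurable_update_prod i)))).re_trace
    have e1 : ∀ z, ((∑ k, f k (z k)) * Φ z).trace.re =
        ∑ i, ∑ k, ((F k z - resample (η i) i (F k) z) * Φ z).trace.re +
          ((∑ k, R k z) * Φ z).trace.re := fun z => by
      have hp : ∑ k, f k (z k) =
          ∑ i, ∑ k, (F k z - resample (η i) i (F k) z) + ∑ k, R k z := by
        rw [Finset.sum_comm, ← Finset.sum_add_distrib]
        refine Finset.sum_congr rfl fun k _ => ?_
        rw [sum_poissonSum_sub_resample (h.isBddMeas k), sub_add_cancel]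
      rw [hp]
      simp only [Matrix.add_mul, Matrix.trace_add, Complex.add_re, Matrix.sum_mul,
        Matrix.trace_sum, Complex.re_sum]
    have e2 : ∫ z, ((∑ k, R k z) * Φ z).trace.re ∂π ≤
        (∑ k, 2 * ‖A k‖) * r ^ N * ∫ z, (Φ z).trace.re ∂π := by
      rw [← integral_const_mul]
      refine integral_mono (((IsBddMeas.sum fun k _ => hR k).matrix_mul hΦ).re_trace.integrable _)
        ((hΦt.integrable _).const_mul _) fun z => ?_
      have hX := h.isHermitian_sum z
      have hpos : 0 ≤ (Φ z).trace.re := by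
        rw [hΦ_def]
        simp only
        rw [hX.re_trace_exp_smul]
        positivity
      refine ((le_abs_self _).trans (hX.abs_re_trace_mul_exp_smul_le _ θ)).trans ?_
      gcongr
      rw [Finset.sum_mul]
      exact norm_sum_le_of_le _ fun k _ => h.norm_glauber_iterate_le hb0 hb1 hb k N z
    have e3 : ∀ i, ∑ k, ∫ z, ((F k z - resample (η i) i (F k) z) * Φ z).trace.re ∂π ≤
        θ * ∫ z, (proxy D A N α i * Φ z).trace.re ∂π := fun i => by
      refine le_trans (le_of_eq ?_) (h.integral_sub_update_mul_le hα0 (hα i) hθ)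
      simp_rw [fun k => (h.reversible i).integral_sub_resample_mul (hF k) hΦ]
      rw [← Finset.sum_div, ← integral_finsetSum _ fun k _ => (hFd k i).integrable _]
      simp only [Matrix.sum_mul, Matrix.trace_sum, Complex.re_sum]
      rfl
    have e4 : ∑ i, ∫ z, (proxy D A N α i * Φ z).trace.re ∂π ≤
        (α + β) * ‖∑ k, A k ^ 2‖ * ∫ z, (Φ z).trace.re ∂π := by
      rw [← integral_finsetSum _ fun i _ => ((hconst _).matrix_mul hΦ).re_trace.integrable _,
        ← integral_const_mul]
      refine integral_mono ((IsBddMeas.sum fun i _ =>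
        ((hconst _).matrix_mul hΦ).re_trace).integrable _) ((hΦt.integrable _).const_mul _)
        fun z => ?_
      simp only [← Complex.re_sum, ← Matrix.trace_sum, ← Matrix.sum_mul]
      exact (h.isHermitian_sum z).re_trace_mul_exp_smul_le θ
        (h.re_inner_sum_proxy_le hα0.le hβ)
    simp_rw [e1]
    rw [integral_add ((IsBddMeas.sum fun i _ => IsBddMeas.sum fun k _ => hFr k i).integrable _)
      (((IsBddMeas.sum fun k _ => hR k).matrix_mul hΦ).re_trace.integrable _),
      integral_finsetSum _ fun i _ => (IsBddMeas.sum fun k _ => hFr k i).integrable _]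
    simp_rw [fun i => integral_finsetSum (μ := π) Finset.univ
      fun k _ => (hFr k i).integrable π]
    calc _ ≤ ∑ i, θ * ∫ z, (proxy D A N α i * Φ z).trace.re ∂π +
          (∑ k, 2 * ‖A k‖) * r ^ N * ∫ z, (Φ z).trace.re ∂π :=
          add_le_add (Finset.sum_le_sum fun i _ => e3 i) e2
      _ ≤ θ * ((α + β) * ‖∑ k, A k ^ 2‖ * ∫ z, (Φ z).trace.re ∂π) +
          (∑ k, 2 * ‖A k‖) * r ^ N * ∫ z, (Φ z).trace.re ∂π := by
          rw [← Finset.mul_sum]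
          gcongr
      _ = _ := by ring
  -- the remainder `glauber^N` of the Poisson equation disappears as `N → ∞`
  have hlim : Filter.Tendsto (fun N : ℕ => (θ * ((α + β) * ‖∑ k, A k ^ 2‖) +
      (∑ k, 2 * ‖A k‖) * r ^ N) * ∫ z, (Φ z).trace.re ∂π) Filter.atTop
      (nhds ((θ * ((α + β) * ‖∑ k, A k ^ 2‖) + (∑ k, 2 * ‖A k‖) * 0) *
        ∫ z, (Φ z).trace.re ∂π)) :=
    (((tendsto_pow_atTop_nhds_zero_of_lt_one hr0 hr1).const_mul _).const_add _).mul_const _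
  rw [mul_zero, add_zero] at hlim
  exact ge_of_tendsto' hlim bound

end DobrushinSystem

end Growth

/-! ### The tail bound for Dobrushin systems -/

section Tail

open scoped Matrix.Norms.L2Operator

variable {d : ℕ}

theorem hasDerivAt_re_trace_exp_smul (X : Matrix (Fin d) (Fin d) ℂ) (θ : ℝ) :
    HasDerivAt (fun θ : ℝ => (NormedSpace.exp (θ • X)).trace.re)
      (X * NormedSpace.exp (θ • X)).trace.re θ :=
  (reTrace d).hasFDerivAt.comp_hasDerivAt θ (hasDerivAt_exp_smul_const' X θ)

theorem continuous_re_trace_mul_exp_smul :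
    Continuous fun p : ℝ × Matrix (Fin d) (Fin d) ℂ =>
      (p.2 * NormedSpace.exp (p.1 • p.2)).trace.re := by
  let _ := NormedAlgebra.restrictScalars ℚ ℝ (Matrix (Fin d) (Fin d) ℂ)
  exact (reTrace d).continuous.comp
    (continuous_snd.mul (NormedSpace.exp_continuous.comp (continuous_fst.smul continuous_snd)))

variable {α : Type*} [MeasurableSpace α] {π : Measure α} {X : α → Matrix (Fin d) (Fin d) ℂ}

theorem hasDerivAt_integral_re_trace_exp_smul [IsFiniteMeasure π] (hX : IsBddMeas X) (θ : ℝ) :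
    HasDerivAt (fun θ : ℝ => ∫ z, (NormedSpace.exp (θ • X z)).trace.re ∂π)
      (∫ z, (X z * NormedSpace.exp (θ • X z)).trace.re ∂π) θ := by
  obtain ⟨C, hC⟩ := hX.bdd
  have : ProperSpace (Matrix (Fin d) (Fin d) ℂ) := FiniteDimensional.proper_real _
  obtain ⟨B, hB⟩ := ((isCompact_closedBall θ 1).prod (isCompact_closedBall
    (0 : Matrix (Fin d) (Fin d) ℂ) C)).exists_bound_of_continuousOn
      continuous_re_trace_mul_exp_smul.continuousOn
  refine (hasDerivAt_integral_of_dominated_loc_of_deriv_le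
    (F' := fun θ z => (X z * NormedSpace.exp (θ • X z)).trace.re) (bound := fun _ => B)
    (Metric.ball_mem_nhds θ one_pos) (Filter.Eventually.of_forall fun x =>
      (hX.exp_smul x).re_trace.stronglyMeasurable.aestronglyMeasurable)
    ((hX.exp_smul θ).re_trace.integrable π)
    ((hX.matrix_mul (hX.exp_smul θ)).re_trace.stronglyMeasurable.aestronglyMeasurable)
    (ae_of_all _ fun z x hx => ?_) (integrable_const B)
    (ae_of_all _ fun z x _ => hasDerivAt_re_trace_exp_smul (X z) x)).2
  exact hB (x, X z) ⟨Metric.ball_subset_closedBall hx, mem_closedBall_zero_iff.2 (hC z)⟩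

/-- A Gronwall argument: the differential inequality `m' ≤ κ θ m` integrates to a Gaussian bound
of the trace moment generating function. -/
theorem integral_re_trace_exp_smul_le [IsProbabilityMeasure π] (hX : IsBddMeas X) {κ : ℝ}
    (h : ∀ θ > 0, ∫ z, (X z * NormedSpace.exp (θ • X z)).trace.re ∂π ≤
      θ * κ * ∫ z, (NormedSpace.exp (θ • X z)).trace.re ∂π) {θ : ℝ} (hθ : 0 ≤ θ) :
    ∫ z, (NormedSpace.exp (θ • X z)).trace.re ∂π ≤ d * Real.exp (κ * θ ^ 2 / 2) := by
  set m : ℝ → ℝ := fun θ => ∫ z, (NormedSpace.exp (θ • X z)).trace.re ∂π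
  have hm : ∀ θ, HasDerivAt m (∫ z, (X z * NormedSpace.exp (θ • X z)).trace.re ∂π) θ :=
    fun θ => hasDerivAt_integral_re_trace_exp_smul hX θ
  have he : ∀ θ : ℝ, HasDerivAt (fun θ : ℝ => Real.exp (-(κ * θ ^ 2 / 2)))
      (Real.exp (-(κ * θ ^ 2 / 2)) * -(κ * θ)) θ := fun θ => by
    refine HasDerivAt.exp (HasDerivAt.congr_deriv
      (((hasDerivAt_pow 2 θ).const_mul κ).div_const 2).neg ?_)
    simp only [Nat.cast_ofNat, Nat.add_one_sub_one, pow_one]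
    ring
  have hd := fun θ => (hm θ).mul (he θ)
  have hanti : AntitoneOn (fun θ => m θ * Real.exp (-(κ * θ ^ 2 / 2))) (Set.Ici 0) := by
    refine antitoneOn_of_deriv_nonpos (convex_Ici 0)
      (fun θ _ => (hd θ).continuousAt.continuousWithinAt)
      (fun θ _ => (hd θ).differentiableAt.differentiableWithinAt) fun θ hθ => ?_
    rw [interior_Ici, Set.mem_Ioi] at hθ
    rw [show deriv (fun θ => m θ * Real.exp (-(κ * θ ^ 2 / 2))) θ = _ from (hd θ).deriv]
    have h1 := mul_le_mul_of_nonneg_right (h θ hθ) (Real.exp_pos (-(κ * θ ^ 2 / 2))).le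
    linarith
  have h0 := hanti Set.self_mem_Ici hθ hθ
  have hm0 : m 0 = d := by simp [m]
  simp only [hm0] at h0
  have h1 := mul_le_mul_of_nonneg_right h0 (Real.exp_pos (κ * θ ^ 2 / 2)).le
  rw [mul_assoc, ← Real.exp_add] at h1
  simpa using h1

/-- The Laplace transform method, with `θ = t / κ`. -/
theorem measureReal_le_lambdaMax_le [IsProbabilityMeasure π] (hd : 1 ≤ d) (hX : IsBddMeas X)
    (hherm : ∀ z, (X z).IsHermitian) {κ : ℝ} (hκ : 0 ≤ κ)
    (h : ∀ θ > 0, ∫ z, (X z * NormedSpace.exp (θ • X z)).trace.re ∂π ≤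
      θ * κ * ∫ z, (NormedSpace.exp (θ • X z)).trace.re ∂π) {t : ℝ} (ht : 0 ≤ t) :
    π.real {z | t ≤ lambdaMax (X z)} ≤ d * Real.exp (-t ^ 2 / (2 * κ)) := by
  -- for `κ = 0` the right side is `d`, because of the division by zero
  rcases hκ.eq_or_lt with rfl | hκ
  · have h1 : (1 : ℝ) ≤ d := by exact_mod_cast hd
    simpa using measureReal_le_one.trans h1
  set θ := t / κ
  have hθ : 0 ≤ θ := by positivity
  have hI := (hX.exp_smul θ).re_trace.integrable π
  have hmarkov := mul_meas_ge_le_integral_of_nonneg (μ := π)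
    (f := fun z => (NormedSpace.exp (θ • X z)).trace.re) (ae_of_all _ fun z => by
      simp only [Pi.zero_apply, (hherm z).re_trace_exp_smul]
      positivity) hI (Real.exp (θ * t))
  have hsub : π.real {z | t ≤ lambdaMax (X z)} ≤
      π.real {z | Real.exp (θ * t) ≤ (NormedSpace.exp (θ • X z)).trace.re} :=
    measureReal_mono fun z (hz : t ≤ lambdaMax (X z)) =>
      (Real.exp_le_exp.2 (mul_le_mul_of_nonneg_left hz hθ)).trans
        (exp_mul_lambdaMax_le hd (hherm z))
  have h1 := (mul_le_mul_of_nonneg_left hsub (Real.exp_pos (θ * t)).le).trans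
    (hmarkov.trans (integral_re_trace_exp_smul_le hX h hθ))
  have h2 := mul_le_mul_of_nonneg_left h1 (Real.exp_pos (-(θ * t))).le
  rw [← mul_assoc, ← Real.exp_add, neg_add_cancel, Real.exp_zero, one_mul, mul_left_comm,
    ← Real.exp_add] at h2
  refine h2.trans (le_of_eq ?_)
  congr 2
  simp only [θ]
  field_simp
  ring

theorem DobrushinSystem.measureReal_le_lambdaMax_le {ι S : Type*} [Fintype ι] [DecidableEq ι]
    [Nonempty ι] [MeasurableSpace S] {π : Measure (ι → S)} [IsProbabilityMeasure π]
    {η : ι → Kernel (ι → S) S} [∀ i, IsMarkovKernel (η i)] {D : Matrix ι ι ℝ}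
    {f : ι → S → Matrix (Fin d) (Fin d) ℂ} {A : ι → Matrix (Fin d) (Fin d) ℂ}
    (h : DobrushinSystem π η D f A) (hd : 1 ≤ d) {a b : ℝ}
    (ha0 : 0 ≤ a) (ha1 : a < 1) (ha : ∀ j, ∑ i, D i j ≤ a)
    (hb0 : 0 ≤ b) (hb1 : b < 1) (hb : ∀ i, ∑ j, D i j ≤ b) {t : ℝ} (ht : 0 ≤ t) :
    π.real {z | t ≤ lambdaMax (∑ k, f k (z k))} ≤
      d * Real.exp (-t ^ 2 / (2 * ((1 / (1 - a) + 1 / (1 - b)) * ‖∑ k, A k ^ 2‖))) := by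
  refine _root_.measureReal_le_lambdaMax_le hd h.isBddMeas_sum h.isHermitian_sum ?_
    (fun θ hθ => h.integral_sum_mul_exp_le ha0 ha1 ha hb0 hb1 hb hθ) ht
  have h1 : 0 < 1 - a := by linarith
  have h2 : 0 < 1 - b := by linarith
  positivity

end Tail

/-! ### Conditional distributions given the other coordinates -/

section CondDist

variable {Ω : Type*} [MeasurableSpace Ω] {n : ℕ} {P : Measure Ω} [IsProbabilityMeasure P]

/-- Replacing the states outside `Λ` by a fixed point of `Λ` makes Dobrushin's condition hold
everywhere, and does not affect the conditional distributions almost surely. -/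
theorem IsDobrushinMatrix.exists_forall_tvDist_le {E : Fin n → Type*}
    [∀ i, MeasurableSpace (E i)] {X : ∀ i, Ω → E i} {Λ : ∀ i, Set (E i)}
    {D : Matrix (Fin n) (Fin n) ℝ} (hX : ∀ i, Measurable (X i))
    (h : IsDobrushinMatrix P X Λ D) :
    ∃ κ : ∀ i, Kernel (∀ j : {j : Fin n // j ≠ i}, E j) (E i),
      (∀ i, IsCondDistOfRest P X i (κ i)) ∧
        ∀ i j (x : ∀ j, E j) (s : E j),
          tvDist (κ i fun l => Function.update x j s l) (κ i fun l => x l) ≤ D i j := by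
  classical
  obtain ⟨κ, hκ, htv⟩ := h.tv_le
  have hne : ∀ i, ∃ x, x ∈ Λ i := fun i => by
    obtain ⟨ω, hω⟩ := (h.mem_states i).exists
    exact ⟨_, hω⟩
  choose x₀ hx₀ using hne
  let ρ : ∀ i, E i → E i := fun i x => if x ∈ Λ i then x else x₀ i
  have hρ : ∀ i, Measurable (ρ i) := fun i =>
    Measurable.ite (h.measurableSet_states i) measurable_id measurable_const
  have hρmem : ∀ i x, ρ i x ∈ Λ i := fun i x => by
    simp only [ρ]
    split_ifs with hx
    exacts [hx, hx₀ i]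
  have hρX : ∀ᵐ ω ∂P, ∀ i, ρ i (X i ω) = X i ω :=
    ae_all_iff.2 fun i => (h.mem_states i).mono fun ω hω => if_pos hω
  have hρr : ∀ i, Measurable fun (x : ∀ j : {j : Fin n // j ≠ i}, E j)
      (j : {j : Fin n // j ≠ i}) => ρ j (x j) := fun i =>
    measurable_pi_lambda _ fun j => (hρ j).comp (measurable_pi_apply j)
  have : ∀ i, IsMarkovKernel (κ i) := fun i => (hκ i).1
  have hrest : ∀ i, Measurable fun ω => fun j : {j : Fin n // j ≠ i} => X j ω := fun i =>
    measurable_pi_lambda _ fun j => hX j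
  refine ⟨fun i => ((κ i).comap _ (hρr i)).map (ρ i),
    fun i => ⟨Kernel.IsMarkovKernel.map _ (hρ i), ?_⟩, fun i j x s => ?_⟩
  · have e1 : ((κ i).comap _ (hρr i)).map (ρ i) =ᵐ[P.map fun ω =>
        fun j : {j : Fin n // j ≠ i} => X j ω] (κ i).map (ρ i) := by
      have hmeas : MeasurableSet {x : ∀ j : {j : Fin n // j ≠ i}, E j |
          ∀ j : {j : Fin n // j ≠ i}, x j ∈ Λ j} := by
        rw [Set.ofPred_forall]
        exact .iInter fun j => measurable_pi_apply j (h.measurableSet_states j)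
      have hae : ∀ᵐ x : ∀ j : {j : Fin n // j ≠ i}, E j ∂P.map fun ω =>
          fun j : {j : Fin n // j ≠ i} => X j ω, ∀ j : {j : Fin n // j ≠ i}, x j ∈ Λ j :=
        (ae_map_iff (hrest i).aemeasurable hmeas).2 (ae_all_iff.2 fun j => h.mem_states j)
      refine hae.mono fun x hx => ?_
      rw [Kernel.map_apply _ (hρ i), Kernel.map_apply _ (hρ i), Kernel.comap_apply]
      congr 3
      exact funext fun j => if_pos (hx j)
    rw [Measure.compProd_congr e1, Measure.compProd_map (hρ i), ← (hκ i).2,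
      Measure.map_map (measurable_id.prodMap (hρ i)) ((hrest i).prodMk (hX i))]
    refine Measure.map_congr (hρX.mono fun ω hω => ?_)
    simp [hω i]
  · have e : ∀ y : ∀ j, E j, ∀ s, MeasurableSet s →
        (((κ i).comap _ (hρr i)).map (ρ i) fun l => y l).real s =
          (κ i fun l => ρ l (y l)).real (ρ i ⁻¹' s) := fun y s hs => by
      rw [Kernel.map_apply _ (hρ i), Kernel.comap_apply, map_measureReal_apply (hρ i) hs]
    refine ciSup_le fun ⟨A, hA⟩ => ?_
    rw [e _ A hA, e _ A hA]
    refine (abs_measureReal_sub_le_tvDist _ _ (hρ i hA)).trans ?_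
    refine (htv i (fun l => ρ l (Function.update x j s l)) (fun l => ρ l (x l))
      (fun l => hρmem _ _) (fun l => hρmem _ _)).trans ?_
    rw [Finset.sum_eq_single j]
    · exact mul_le_of_le_one_right (h.nonneg i j) (by split_ifs <;> norm_num)
    · intro l _ hl
      rw [Function.update_of_ne hl]
      simp
    · simp

variable {S : Type*} [MeasurableSpace S] {X : Fin n → Ω → S} {i : Fin n}

theorem measurable_restrict_ne (i : Fin n) :
    Measurable fun (z : Fin n → S) (j : {j : Fin n // j ≠ i}) => z j :=
  measurable_pi_lambda _ fun _ => measurable_pi_apply _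

/-- Resampling a coordinate from its conditional distribution given the others is reversible: given
the other coordinates, the old and the new value are independent and identically distributed. -/
theorem IsCondDistOfRest.isReversibleResample (hX : ∀ i, Measurable (X i))
    {κ : Kernel ({j : Fin n // j ≠ i} → S) S} (h : IsCondDistOfRest (E := fun _ => S) P X i κ) :
    IsReversibleResample (P.map fun ω k => X k ω) (κ.comap _ (measurable_restrict_ne i)) i := by
  classical
  have := h.1
  set q := P.map fun ω => fun j : {j : Fin n // j ≠ i} => X j ω
  have hrest : Measurable fun ω => fun j : {j : Fin n // j ≠ i} => X j ω :=
    measurable_pi_lambda _ fun j => hX j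
  have : IsProbabilityMeasure q := Measure.isProbabilityMeasure_map hrest.aemeasurable
  -- a state is assembled from its coordinates other than `i` and its `i`-th coordinate
  let glue : ({j : Fin n // j ≠ i} → S) × S → Fin n → S :=
    fun p j => if hj : j = i then p.2 else p.1 ⟨j, hj⟩
  have hglue : Measurable glue := measurable_pi_lambda _ fun j => by
    by_cases hj : j = i
    · simpa [glue, hj] using measurable_snd
    · simp only [glue, dif_neg hj]
      exact (measurable_pi_apply _).comp measurable_fst
  have hupd : ∀ b s u, Function.update (glue (b, s)) i u = glue (b, u) := fun b s u => by
    ext j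
    by_cases hj : j = i
    · subst hj
      simp [glue]
    · simp [glue, hj]
  have hres : ∀ b s, (fun j : {j : Fin n // j ≠ i} => glue (b, s) j) = b := fun b s =>
    funext fun j => by simp [glue, j.2]
  have hπ : (P.map fun ω k => X k ω) = (q.compProd κ).map glue := by
    rw [← h.2, Measure.map_map hglue (hrest.prodMk (hX i))]
    congr 1
    ext ω j
    by_cases hj : j = i
    · subst hj
      simp [glue]
    · simp [glue, hj]
  have hπp : IsProbabilityMeasure (P.map fun ω k => X k ω) :=
    Measure.isProbabilityMeasure_map (measurable_pi_lambda _ hX).aemeasurable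
  have hpair : Measurable fun p : (Fin n → S) × S => (p.1, Function.update p.1 i p.2) :=
    measurable_fst.prodMk (measurable_update_prod i)
  have key : ∀ g : (Fin n → S) × (Fin n → S) → ENNReal, Measurable g →
      ∫⁻ p, g p ∂resamplePair (P.map fun ω k => X k ω)
        (κ.comap _ (measurable_restrict_ne i)) i =
      ∫⁻ b, ∫⁻ s, ∫⁻ u, g (glue (b, s), glue (b, u)) ∂κ b ∂κ b ∂q := fun g hg => by
    have hin : Measurable fun z : Fin n → S => ∫⁻ u, g (z, Function.update z i u)
        ∂(κ.comap _ (measurable_restrict_ne i)) z :=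
      (hg.comp hpair).lintegral_kernel_prod_right'
    have hg2 : Measurable fun p : (Fin n → S) × S => g (p.1, Function.update p.1 i p.2) :=
      hg.comp hpair
    have hin2 : Measurable fun p => ∫⁻ u, g (glue p, Function.update (glue p) i u)
        ∂(κ.comap _ (measurable_restrict_ne i)) (glue p) := hin.comp hglue
    rw [resamplePair, lintegral_map hg hpair, Measure.lintegral_compProd hg2, hπ,
      lintegral_map hin hglue, Measure.lintegral_compProd hin2]
    simp only [hupd, Kernel.comap_apply, hres]
  refine Measure.ext_of_lintegral _ fun g hg => ?_
  rw [lintegral_map hg measurable_swap, key (fun p => g p.swap) (hg.comp measurable_swap), key g hg]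
  refine lintegral_congr fun b => ?_
  have hgl : ∀ b, Measurable fun s => glue (b, s) := fun b => hglue.comp measurable_prodMk_left
  exact lintegral_lintegral_swap (f := fun s u => g (glue (b, u), glue (b, s)))
    (hg.comp (((hgl b).comp measurable_snd).prodMk ((hgl b).comp measurable_fst))).aemeasurable

theorem ProbabilityTheory.iIndepFun.isCondDistOfRest_const (hX : ∀ i, Measurable (X i))
    (h : iIndepFun X P) :
    IsCondDistOfRest (E := fun _ => S) P X i (Kernel.const _ (P.map (X i))) := by
  have := Measure.isProbabilityMeasure_map (μ := P) (hX i).aemeasurable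
  refine ⟨inferInstance, ?_⟩
  have hrest : Measurable fun ω => fun j : {j : Fin n // j ≠ i} => X j ω :=
    measurable_pi_lambda _ fun j => hX j
  have hψ : Measurable fun x : ({i} : Finset (Fin n)) → S => x ⟨i, by simp⟩ :=
    measurable_pi_apply _
  have hind := (h.indepFun_finset (Finset.univ.erase i) {i} (by simp) hX).comp
    (φ := fun x (j : {j : Fin n // j ≠ i}) => x ⟨j, by simp [j.2]⟩)
    (measurable_pi_lambda _ fun j => measurable_pi_apply _) hψ
  rw [Measure.compProd_const]
  exact (indepFun_iff_map_prod_eq_prod_map_map hrest.aemeasurable (hX i).aemeasurable).1 hind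

end CondDist

/-! ### Matrix Hoeffding inequality -/

section MatrixNorms

variable {n : ℕ} {D : Matrix (Fin n) (Fin n) ℝ}

theorem matNormOne_nonneg (D : Matrix (Fin n) (Fin n) ℝ) : 0 ≤ matNormOne D :=
  Real.iSup_nonneg fun _ => Finset.sum_nonneg fun _ _ => abs_nonneg _

theorem matNormInf_nonneg (D : Matrix (Fin n) (Fin n) ℝ) : 0 ≤ matNormInf D :=
  Real.iSup_nonneg fun _ => Finset.sum_nonneg fun _ _ => abs_nonneg _

theorem sum_col_le_matNormOne (D : Matrix (Fin n) (Fin n) ℝ) (j : Fin n) :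
    ∑ i, D i j ≤ matNormOne D :=
  (Finset.sum_le_sum fun _ _ => le_abs_self _).trans
    (le_ciSup (f := fun j => ∑ i, |D i j|) (Set.finite_range _).bddAbove j)

theorem sum_row_le_matNormInf (D : Matrix (Fin n) (Fin n) ℝ) (i : Fin n) :
    ∑ j, D i j ≤ matNormInf D :=
  (Finset.sum_le_sum fun _ _ => le_abs_self _).trans
    (le_ciSup (f := fun i => ∑ j, |D i j|) (Set.finite_range _).bddAbove i)

theorem matNormOne_zero : matNormOne (0 : Matrix (Fin n) (Fin n) ℝ) = 0 := by
  simp [matNormOne]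

theorem matNormInf_zero : matNormInf (0 : Matrix (Fin n) (Fin n) ℝ) = 0 := by
  simp [matNormInf]

/-- Independent coordinates do not influence each other: their conditional distributions are
constant. -/
theorem isDobrushinMatrix_zero {Ω S : Type*} [MeasurableSpace Ω] [MeasurableSpace S]
    {P : Measure Ω} [IsProbabilityMeasure P] {X : Fin n → Ω → S}
    (hX : ∀ i, Measurable (X i)) (h : iIndepFun X P) :
    IsDobrushinMatrix (E := fun _ => S) P X (fun _ => Set.univ) 0 where
  measurableSet_states _ := .univ
  mem_states _ := ae_of_all _ fun _ => Set.mem_univ _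
  nonneg _ _ := le_rfl
  diag_eq_zero _ := rfl
  tv_le := ⟨fun i => Kernel.const _ (P.map (X i)), fun _ => h.isCondDistOfRest_const hX,
    fun i x y _ _ => by simp [tvDist]⟩

end MatrixNorms

section Hoeffding

open scoped Matrix.Norms.L2Operator

local notation "op" => Matrix.toEuclideanCLM (𝕜 := ℂ)

variable {d : ℕ}

theorem lambdaMax_zero (hd : 1 ≤ d) : lambdaMax (0 : Matrix (Fin d) (Fin d) ℂ) = 0 := by
  have : NeZero d := ⟨by omega⟩
  rw [lambdaMax, spectrum.zero_eq, csSup_singleton]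

theorem Matrix.IsHermitian.norm_apply_le_of_sq_le {A Y : Matrix (Fin d) (Fin d) ℂ}
    (hA : A.IsHermitian) (hY : Y.IsHermitian) (h : (A ^ 2 - Y ^ 2).PosSemidef)
    (v : EuclideanSpace ℂ (Fin d)) : ‖op Y v‖ ≤ ‖op A v‖ := by
  have h1 : 0 ≤ (inner ℂ v (op (A ^ 2 - Y ^ 2) v)).re := by
    have h2 := (Matrix.isPositive_toEuclideanLin_iff.2 h).2 v
    rwa [← Matrix.coe_toEuclideanCLM_eq_toEuclideanLin, ContinuousLinearMap.coe_coe,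
      ← inner_conj_symm, RCLike.conj_re] at h2
  rw [map_sub, _root_.sub_apply, inner_sub_right, Complex.sub_re, hA.re_inner_sq, hY.re_inner_sq,
    sub_nonneg] at h1
  exact (sq_le_sq₀ (norm_nonneg _) (norm_nonneg _)).1 h1

theorem isClosed_setOf_isHermitian_norm_apply_le (A : Matrix (Fin d) (Fin d) ℂ) :
    IsClosed {y : Matrix (Fin d) (Fin d) ℂ | y.IsHermitian ∧ ∀ v, ‖op y v‖ ≤ ‖op A v‖} := by
  have h : IsClosed {y : Matrix (Fin d) (Fin d) ℂ | ∀ v, ‖op y v‖ ≤ ‖op A v‖} := by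
    rw [Set.ofPred_forall]
    exact isClosed_iInter fun v => isClosed_le (evalAt v).continuous.norm continuous_const
  exact IsClosed.inter (isClosed_eq continuous_star continuous_id) h

instance Matrix.instBorelSpacePi : BorelSpace (Matrix (Fin d) (Fin d) ℂ) :=
  inferInstanceAs (BorelSpace (Fin d → Fin d → ℂ))

theorem integral_matrix_eq_zero {Ω : Type*} [MeasurableSpace Ω] {P : Measure Ω}
    {f : Ω → Matrix (Fin d) (Fin d) ℂ} (hf : Integrable f P)
    (h : ∀ a b, ∫ ω, f ω a b ∂P = 0) : ∫ ω, f ω ∂P = 0 := by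
  ext a b
  exact ((LinearMap.toContinuousLinearMap
    (Matrix.entryLinearMap ℝ ℂ a b)).integral_comp_comm hf).symm.trans (h a b)

variable {Ω : Type*} [MeasurableSpace Ω] {P : Measure Ω} [IsProbabilityMeasure P] {n : ℕ}
  {Y : Fin n → Ω → Matrix (Fin d) (Fin d) ℂ} {A : Fin n → Matrix (Fin d) (Fin d) ℂ}

theorem IsDobrushinMatrix.measureReal_le_lambdaMax_le (hd : 1 ≤ d)
    (hYmeas : ∀ k, Measurable (Y k)) (hYherm : ∀ k ω, (Y k ω).IsHermitian)
    (hA : ∀ k, (A k).IsHermitian) (hmean : ∀ k, ∀ a b : Fin d, ∫ ω, Y k ω a b ∂P = 0)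
    (hbound : ∀ k, ∀ᵐ ω ∂P, ((A k) ^ 2 - (Y k ω) ^ 2).PosSemidef)
    {Λ : Fin n → Set (Matrix (Fin d) (Fin d) ℂ)} {D : Matrix (Fin n) (Fin n) ℝ}
    (hD : IsDobrushinMatrix P Y Λ D) (hlt : max (matNormOne D) (matNormInf D) < 1) {t : ℝ}
    (ht : 0 ≤ t) :
    P.real {ω | t ≤ lambdaMax (∑ k, Y k ω)} ≤
      d * Real.exp (-t ^ 2 / (4 * dobrushinConst D * matOpNorm (∑ k, (A k) ^ 2))) := by
  classical
  -- for `n = 0` the exponent is a division by zero, and the right side is `d`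
  rcases isEmpty_or_nonempty (Fin n) with hn | hn
  · have h1 : (1 : ℝ) ≤ d := by exact_mod_cast hd
    simpa [matOpNorm] using measureReal_le_one.trans h1
  obtain ⟨κ, hκ, htv⟩ := hD.exists_forall_tvDist_le hYmeas
  have : ∀ i, IsMarkovKernel (κ i) := fun i => (hκ i).1
  -- the truncation of `Y k` to the matrices that satisfy the almost sure bound
  set T : Fin n → Set (Matrix (Fin d) (Fin d) ℂ) :=
    fun k => {y | y.IsHermitian ∧ ∀ v, ‖op y v‖ ≤ ‖op (A k) v‖}
  set f : Fin n → Matrix (Fin d) (Fin d) ℂ → Matrix (Fin d) (Fin d) ℂ :=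
    fun k y => if y ∈ T k then y else 0
  have hf : ∀ k, Measurable (f k) := fun k =>
    Measurable.ite (isClosed_setOf_isHermitian_norm_apply_le (A k)).measurableSet measurable_id
      measurable_const
  have hfT : ∀ k y, (f k y).IsHermitian ∧ ∀ v, ‖op (f k y) v‖ ≤ ‖op (A k) v‖ := fun k y => by
    simp only [f]
    split_ifs with h
    · exact h
    · simp
  have hfY : ∀ᵐ ω ∂P, ∀ k, f k (Y k ω) = Y k ω := ae_all_iff.2 fun k =>
    (hbound k).mono fun ω hω =>
      if_pos ⟨hYherm k ω, (hA k).norm_apply_le_of_sq_le (hYherm k ω) hω⟩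
  set π := P.map fun ω k => Y k ω
  have hYm : Measurable fun ω k => Y k ω := measurable_pi_lambda _ hYmeas
  have : IsProbabilityMeasure π := Measure.isProbabilityMeasure_map hYm.aemeasurable
  have hsys : DobrushinSystem π (fun i => (κ i).comap _ (measurable_restrict_ne i)) D f A :=
    { reversible := fun i => (hκ i).isReversibleResample hYmeas
      nonneg := hD.nonneg
      tv_le := fun i j z s => htv i j z s
      stronglyMeasurable := fun k => (hf k).stronglyMeasurable
      isHermitian := fun k y => (hfT k y).1
      isHermitian_bound := hA
      norm_le := fun k y => (hfT k y).2
      mean_zero := fun k => by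
        have hb : IsBddMeas fun z : Fin n → Matrix (Fin d) (Fin d) ℂ => f k (z k) := by
          refine ⟨((hf k).comp (measurable_pi_apply k)).stronglyMeasurable, ‖A k‖, fun z => ?_⟩
          exact Matrix.l2_opNorm_le_of_forall (norm_nonneg _) fun v =>
            ((hfT k _).2 v).trans (Matrix.norm_toEuclideanCLM_apply_le _ v)
        rw [integral_map hYm.aemeasurable hb.stronglyMeasurable.aestronglyMeasurable]
        refine integral_matrix_eq_zero ((hb.comp hYm).integrable P) fun a b => ?_
        rw [← hmean k a b]
        exact integral_congr_ae (hfY.mono fun ω hω => by simp only [hω k]) }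
  have h1 := (max_lt_iff.1 hlt).1
  have h2 := (max_lt_iff.1 hlt).2
  have htail := hsys.measureReal_le_lambdaMax_le hd (matNormOne_nonneg D) h1
    (sum_col_le_matNormOne D) (matNormInf_nonneg D) h2 (sum_row_le_matNormInf D) ht
  have hle : P.real {ω | t ≤ lambdaMax (∑ k, Y k ω)} ≤
      π.real {z | t ≤ lambdaMax (∑ k, f k (z k))} := by
    refine ENNReal.toReal_mono (measure_ne_top _ _) (le_trans (measure_mono_ae ?_)
      (Measure.le_map_apply hYm.aemeasurable _))
    filter_upwards [hfY] with ω hω h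
    show t ≤ lambdaMax (∑ k, f k (Y k ω))
    simp only [hω]
    exact h
  refine hle.trans (htail.trans (le_of_eq ?_))
  rw [dobrushinConst, matOpNorm, ← Matrix.l2_opNorm_toEuclideanCLM]
  congr 3
  ring

theorem measureReal_le_lambdaMax_eq_zero (hd : 1 ≤ d)
    (hYherm : ∀ k ω, (Y k ω).IsHermitian) (hA : ∀ k, (A k).IsHermitian)
    (hbound : ∀ k, ∀ᵐ ω ∂P, ((A k) ^ 2 - (Y k ω) ^ 2).PosSemidef)
    (hσ : matOpNorm (∑ k, (A k) ^ 2) = 0) {t : ℝ} (ht : 0 < t) :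
    P.real {ω | t ≤ lambdaMax (∑ k, Y k ω)} = 0 := by
  have hA0 : ∀ k v, op (A k) v = 0 := fun k v => by
    have h1 : ∑ k, (inner ℂ v (op (A k ^ 2) v)).re = 0 := by
      rw [← Complex.re_sum, ← inner_sum, ← sum_apply, ← map_sum, norm_eq_zero.1 hσ]
      simp
    simp_rw [fun k => (hA k).re_inner_sq v] at h1
    have h2 := (Finset.sum_eq_zero_iff_of_nonneg fun k _ => by positivity).1 h1 k
      (Finset.mem_univ k)
    exact norm_eq_zero.1 (pow_eq_zero_iff two_ne_zero |>.1 h2)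
  have hY0 : ∀ᵐ ω ∂P, ∀ k, Y k ω = 0 := ae_all_iff.2 fun k => (hbound k).mono fun ω hω => by
    refine (Matrix.toEuclideanCLM (𝕜 := ℂ) (n := Fin d)).injective ?_
    ext1 v
    have h := (hA k).norm_apply_le_of_sq_le (hYherm k ω) hω v
    rw [hA0, norm_zero] at h
    rw [map_zero]
    exact norm_le_zero_iff.1 h
  rw [measureReal_eq_zero_iff]
  refine measure_eq_zero_iff_ae_notMem.2 (hY0.mono fun ω hω h => ?_)
  have h' : t ≤ lambdaMax (∑ k, Y k ω) := h
  simp only [hω, Finset.sum_const_zero, lambdaMax_zero hd] at h'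
  linarith

end Hoeffding

theorem mainTheorem2 {Ω : Type*} [MeasurableSpace Ω] (P : Measure Ω) [IsProbabilityMeasure P]
    (n d : ℕ) (hd : 1 ≤ d)
    (Y : Fin n → Ω → Matrix (Fin d) (Fin d) ℂ) (A : Fin n → Matrix (Fin d) (Fin d) ℂ)
    (hYmeas : ∀ k, Measurable (Y k))
    (hYherm : ∀ k ω, (Y k ω).IsHermitian)
    (hA : ∀ k, (A k).IsHermitian)
    (hmean : ∀ k, ∀ a b : Fin d, ∫ ω, Y k ω a b ∂P = 0)
    (hbound : ∀ k, ∀ᵐ ω ∂P, ((A k) ^ 2 - (Y k ω) ^ 2).PosSemidef)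
    (σsq : ℝ) (hσ : σsq = matOpNorm (∑ k, (A k) ^ 2)) :
    -- independent case
    (iIndepFun Y P →
      ∀ t : ℝ, 0 ≤ t →
        P.real {ω | t ≤ lambdaMax (∑ k, Y k ω)} ≤ d * Real.exp (-t ^ 2 / (4 * σsq))) ∧
    -- weakly dependent case
    (∀ (Λ : Fin n → Set (Matrix (Fin d) (Fin d) ℂ)) (D : Matrix (Fin n) (Fin n) ℝ),
      IsDobrushinMatrix P Y Λ D →
      max (matNormOne D) (matNormInf D) < 1 →
      ∀ t : ℝ, 0 ≤ t →
        P.real {ω | t ≤ lambdaMax (∑ k, Y k ω)} ≤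
          d * Real.exp (-t ^ 2 / (4 * dobrushinConst D * σsq))) ∧
    -- in the degenerate case `σ² = 0` the exponentials above are read as `0` for `t > 0`
    (σsq = 0 → ∀ t : ℝ, 0 < t → P.real {ω | t ≤ lambdaMax (∑ k, Y k ω)} = 0) := by
  subst hσ
  have hdep : ∀ (Λ : Fin n → Set (Matrix (Fin d) (Fin d) ℂ)) (D : Matrix (Fin n) (Fin n) ℝ),
      IsDobrushinMatrix P Y Λ D → max (matNormOne D) (matNormInf D) < 1 → ∀ t : ℝ, 0 ≤ t →
        P.real {ω | t ≤ lambdaMax (∑ k, Y k ω)} ≤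
          d * Real.exp (-t ^ 2 / (4 * dobrushinConst D * matOpNorm (∑ k, (A k) ^ 2))) :=
    fun _ _ hD hlt _ ht =>
      hD.measureReal_le_lambdaMax_le hd hYmeas hYherm hA hmean hbound hlt ht
  refine ⟨fun hind t ht => ?_, hdep, fun hσ t ht =>
    measureReal_le_lambdaMax_eq_zero hd hYherm hA hbound hσ ht⟩
  have h := hdep _ _ (isDobrushinMatrix_zero hYmeas hind)
    (by rw [matNormOne_zero, matNormInf_zero, max_self]; exact one_pos) t ht
  have hc : dobrushinConst (0 : Matrix (Fin n) (Fin n) ℝ) = 1 := by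
    rw [dobrushinConst, matNormOne_zero, matNormInf_zero]
    norm_num
  rwa [hc, mul_one] at h
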